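/- All entropies are in bits. Let $(X_Q,Y_Q,Z)$ have law $P$, where $X_Q$ takes values in a countable alphabet, $Y_Q$ in an arbitrary measurable space and $Z$ in $\mathbb R^d$ with a density. Let $(X_Q^n,Y_Q^n,Z^n)$ be $n$ i.i.d. copies (memoryless source). For $V=Z$ or $V=(Z,X_Q)$, let $p_V$ be the density of $V$ with respect to Lebesgue measure, resp. Lebesgue $\times$ counting measure, let $H(V)=\mathbb E[-\log_2 p_V(V)]$ (if $\log p_V(V)$ is not integrable, the exponents below are read as $+\infty$), and put, with values in $[-\infty,\infty]$, $$C_V^{(1)}(\epsilon)=\inf_{s>0}\big(\ln\mathbb E[p_V(V)^{-s/\ln 2}]-s(H(V)+\epsilon)\big),\qquad C_V^{(2)}(\epsilon)=\inf_{s>0}\big(\ln\mathbb E[p_V(V)^{s/\ln 2}]-s(-H(V)+\epsilon)\big).$$ Let $\mathbb H(X_Q|Z)=\mathbb E[-\log_2 (p_{ZX_Q}(Z,X_Q)/p_Z(Z))]$. Sequential key generation. Reconciliation: a public message $F$ with values in a finite set $\mathcal F$, $\log_2|\mathcal F|\le l_{\rm rec}$, is disclosed, and Bob forms an estimate $\hat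 X^n$ of $X_Q^n$ from $(Y_Q^n,F)$; let $\mathbf P_{\rm rec}=\mathbb P(\hat X^n\ne X_Q^n)$. Privacy amplification: a random function $G$ with values in $\{0,1\}^k$, independent of $(X_Q^n,Y_Q^n,Z^n,F)$ and universal$_2$, i.e. $\mathbb P(G(x)=G(x'))\le 2^{-k}$ for all $x\ne x'$, is disclosed; Alice computes $K=G(X_Q^n)$ and Bob $\hat K=G(\hat X^n)$. For parameters $t=(\epsilon,\epsilon',b_0,b_1,f,g)$ put $$\delta^{(1)}(n)=\sum_{i=1}^2e^{nC_Z^{(i)}(\epsilon)}+2^{-nb_1\epsilon}+2^{-n(b_1-b_0)\epsilon},\quad \delta^{(2)}(n)=2^{-nb_0\epsilon},\quad \delta^{(3)}(n)=2^{-f(n)}+\delta^{(1)}(n),\quad \delta^{(4)}(n)=\log_2(1+2^{-g(n)}),$$ $$\bar k(t)=\Big\lfloor n(\mathbb H(X_Q|Z)-\epsilon-\epsilon')+\log_2(1-\delta^{(2)}(n))-l_{\rm rec}-2f(n)-g(n)-2\Big\rfloor,\qquad \delta^{(5)}(n)=\delta^{(3)}(n)\big(\bar k(t)-\delta^{(4)}(n)\big)+\delta^{(4)}(n).$$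 Fix $n$ and $\epsilon_L,\epsilon_U>0$. Let $\mathcal C(\epsilon_L,\epsilon_U)$ be the set of $t$ with $\epsilon,\epsilon',b_0,b_1\in[0,1]$, $\epsilon>0$, $0<b_0<b_1$, $f,g:\mathbb N\to[0,\infty)$, $f(m)=o(m)$, $g(m)=o(m)$, such that for some $n_0<n$ $$\sum_{i=1}^2\Big(e^{mC_Z^{(i)}(\epsilon')}+e^{mC_{ZX_Q}^{(i)}(\epsilon')}\Big)\le 2^{-b_1m\epsilon}\quad\text{for all } m>n_0,$$ and $\delta^{(5)}(n)\le\min(\epsilon_L,\epsilon_U)$. Assume $\mathcal C(\epsilon_L,\epsilon_U)\neq\emptyset$. Then $k^*=\sup_{t\in\mathcal C(\epsilon_L,\epsilon_U)}\bar k(t)$ is finite, and the key length $k=\max(k^*,0)$ is achieved: universal$_2$ random functions from the set of sequences $x^n$ to $\{0,1\}^k$ exist, and with every such $G$ $$\mathbf L=I(K;Z^nF)<\epsilon_L,\quad\text{and even}\quad I(K;G Z^nF)<\epsilon_L,\qquad \mathbf U=k-H(K)<\epsilon_U,\qquad \mathbf P_{\rm d}=\mathbb P(K\ne\hat K)\le\mathbf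 P_{\rm rec}.$$ -/

import Mathlib

open MeasureTheory ProbabilityTheory Filter Asymptotics
open scoped ENNReal

noncomputable section

namespace FiniteKey

/-! ### Entropies and Chernoff exponents of a law with a density

`μ` is a law and `ν` the reference measure with respect to which its density `p = dμ/dν` is taken:
Lebesgue measure for a continuous variable, Lebesgue measure times counting measure for a pair
(continuous, discrete). All logarithms in entropies are to base `2`. -/

/-- The entropy `H = E[-log₂ p]` of the law `μ` with density `p = dμ/dν`. -/
def entropy {E : Type*} [MeasurableSpace E] (ν μ : Measure E) : ℝ :=
  ∫ x, -Real.logb 2 (μ.rnDeriv ν x).toReal ∂μ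

/-- `C⁽¹⁾(ε) = inf_{s > 0} (ln E[p^{-s / ln 2}] - s (H + ε))`, with values in `[-∞, ∞]`. A value of
`s` whose expectation is infinite contributes `+∞`. -/
def chernoff₁ {E : Type*} [MeasurableSpace E] (ν μ : Measure E) (ε : ℝ) : EReal :=
  ⨅ (s : ℝ) (_ : 0 < s),
    (ENNReal.log (∫⁻ x, (μ.rnDeriv ν x) ^ (-s / Real.log 2) ∂μ)
      - ((s * (entropy ν μ + ε) : ℝ) : EReal))

/-- `C⁽²⁾(ε) = inf_{s > 0} (ln E[p^{s / ln 2}] - s (-H + ε))`, with values in `[-∞, ∞]`. If both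
`C⁽¹⁾(ε)` and `C⁽²⁾(ε)` are `< ∞`, then `log p` has exponential moments of both signs, so that
`entropy ν μ` is the integral of an integrable function. -/
def chernoff₂ {E : Type*} [MeasurableSpace E] (ν μ : Measure E) (ε : ℝ) : EReal :=
  ⨅ (s : ℝ) (_ : 0 < s),
    (ENNReal.log (∫⁻ x, (μ.rnDeriv ν x) ^ (s / Real.log 2) ∂μ)
      - ((s * (-entropy ν μ + ε) : ℝ) : EReal))

/-- `∑_{i = 1, 2} exp (n C⁽ⁱ⁾(ε))`. -/
def chernoffSum {E : Type*} [MeasurableSpace E] (ν μ : Measure E) (n : ℕ) (ε : ℝ) : ℝ≥0∞ :=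
  EReal.exp ((n : EReal) * chernoff₁ ν μ ε) + EReal.exp ((n : EReal) * chernoff₂ ν μ ε)

/-! ### The pair `(Z, X)`: `Z` continuous in `ℝ^d`, `X` discrete, with joint law `Q` -/

section Pair

variable {d : ℕ} {𝒳 : Type*} [MeasurableSpace 𝒳]

/-- The reference measure for densities of `(Z, X)`: Lebesgue measure times counting measure. -/
def refZX (d : ℕ) (𝒳 : Type*) [MeasurableSpace 𝒳] : Measure ((Fin d → ℝ) × 𝒳) :=
  (volume : Measure (Fin d → ℝ)).prod Measure.count

/-- The conditional entropy `H(X | Z) = E[-log₂ (p(Z, X) / p(Z))]`. -/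
def condEntropyXZ (Q : Measure ((Fin d → ℝ) × 𝒳)) : ℝ :=
  ∫ w, -Real.logb 2
    ((Q.rnDeriv (refZX d 𝒳) w).toReal / (Q.fst.rnDeriv volume w.1).toReal) ∂Q

/-- The free parameters `(ε, ε', b₀, b₁, f, g)` of the analysis. -/
structure Params where
  ε : ℝ
  ε' : ℝ
  b₀ : ℝ
  b₁ : ℝ
  f : ℕ → ℝ
  g : ℕ → ℝ

/-- `δ⁽¹⁾(n) = ∑ᵢ exp (n C_Z⁽ⁱ⁾(ε)) + 2^{-n b₁ ε} + 2^{-n (b₁ - b₀) ε}`. -/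
def δ₁ (Q : Measure ((Fin d → ℝ) × 𝒳)) (n : ℕ) (t : Params) : ℝ≥0∞ :=
  chernoffSum volume Q.fst n t.ε + ENNReal.ofReal ((2 : ℝ) ^ (-(n * t.b₁ * t.ε)))
    + ENNReal.ofReal ((2 : ℝ) ^ (-(n * (t.b₁ - t.b₀) * t.ε)))

/-- `δ⁽²⁾(n) = 2^{-n b₀ ε}`. -/
def δ₂ (n : ℕ) (t : Params) : ℝ := (2 : ℝ) ^ (-(n * t.b₀ * t.ε))

/-- `δ⁽³⁾(n) = 2^{-f(n)} + δ⁽¹⁾(n)`. -/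
def δ₃ (Q : Measure ((Fin d → ℝ) × 𝒳)) (n : ℕ) (t : Params) : ℝ≥0∞ :=
  ENNReal.ofReal ((2 : ℝ) ^ (-t.f n)) + δ₁ Q n t

/-- `δ⁽⁴⁾(n) = log₂ (1 + 2^{-g(n)})`. -/
def δ₄ (n : ℕ) (t : Params) : ℝ := Real.logb 2 (1 + (2 : ℝ) ^ (-t.g n))

/-- The key length
`⌊n (H(X|Z) - ε - ε') + log₂ (1 - δ⁽²⁾(n)) - l_rec - 2 f(n) - g(n) - 2⌋` of the parameters `t`. -/
def kbar (Q : Measure ((Fin d → ℝ) × 𝒳)) (n : ℕ) (lrec : ℝ) (t : Params) : ℤ :=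
  ⌊n * (condEntropyXZ Q - t.ε - t.ε') + Real.logb 2 (1 - δ₂ n t) - lrec
    - 2 * t.f n - t.g n - 2⌋

/-- `δ⁽⁵⁾(n) = δ⁽³⁾(n) (k - δ⁽⁴⁾(n)) + δ⁽⁴⁾(n)`, where `k` is the key length `kbar` of the same
parameters. -/
def δ₅ (Q : Measure ((Fin d → ℝ) × 𝒳)) (n : ℕ) (lrec : ℝ) (t : Params) : EReal :=
  (δ₃ Q n t : EReal) * (((kbar Q n lrec t : ℝ) - δ₄ n t : ℝ) : EReal) + (δ₄ n t : EReal)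

/-- The constraint set `C(ε_L, ε_U)` at block length `n`. The points of the cube with `ε = 0` or
`b₀ = 0` are left out: there `δ⁽²⁾(n) = 1`, and the key length would be `-∞`. -/
def admissible (Q : Measure ((Fin d → ℝ) × 𝒳)) (n : ℕ) (lrec εL εU : ℝ) : Set Params :=
  {t | t.ε ∈ Set.Ioc (0 : ℝ) 1 ∧ t.ε' ∈ Set.Icc (0 : ℝ) 1 ∧
    t.b₀ ∈ Set.Ioc (0 : ℝ) 1 ∧ t.b₁ ∈ Set.Icc (0 : ℝ) 1 ∧
    (∀ m, 0 ≤ t.f m) ∧ (∀ m, 0 ≤ t.g m) ∧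
    (∃ n₀ < n, ∀ m > n₀,
      chernoffSum volume Q.fst m t.ε' + chernoffSum (refZX d 𝒳) Q m t.ε'
        ≤ ENNReal.ofReal ((2 : ℝ) ^ (-(t.b₁ * m * t.ε)))) ∧
    t.b₀ < t.b₁ ∧
    t.f =o[atTop] (fun m : ℕ => (m : ℝ)) ∧ t.g =o[atTop] (fun m : ℕ => (m : ℝ)) ∧
    δ₅ Q n lrec t ≤ ((min εL εU : ℝ) : EReal)}

/-- The set of key lengths over which the supremum is taken. -/
def keyLengths (Q : Measure ((Fin d → ℝ) × 𝒳)) (n : ℕ) (lrec εL εU : ℝ) : Set ℤ :=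
  kbar Q n lrec '' admissible Q n lrec εL εU

/-- `k = sup_{C(ε_L, ε_U)} kbar`. -/
def keyLength (Q : Measure ((Fin d → ℝ) × 𝒳)) (n : ℕ) (lrec εL εU : ℝ) : ℤ :=
  sSup (keyLengths Q n lrec εL εU)

end Pair

/-! ### Hashing, and the figures of merit of a key `K` with values in a finite set `𝒦` -/

/-- A random function `h s : A → 𝒦`, with seed `s` of law `σ`, is universal₂: any two distinct
points collide with probability at most `1 / |𝒦|`. (For `σ` uniform on a finite set this is a
uniformly chosen member of a universal₂ family.) -/
structure IsUniversal₂ {𝒮 A 𝒦 : Type*} [MeasurableSpace 𝒮] [Fintype 𝒦] [MeasurableSpace 𝒦]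
    (σ : Measure 𝒮) (h : 𝒮 → A → 𝒦) : Prop where
  measurable : ∀ x, Measurable fun s => h s x
  collision : ∀ x x', x ≠ x' → σ {s | h s x = h s x'} ≤ (Fintype.card 𝒦 : ℝ≥0∞)⁻¹

section Key

variable {Ω 𝒦 𝒲 : Type*} [MeasurableSpace Ω] [MeasurableSpace 𝒲]
  [Fintype 𝒦] [MeasurableSpace 𝒦]

/-- Shannon entropy, in bits, of a law on a finite set. -/
def shannon (κ : Measure 𝒦) : ℝ := ∑ k, Real.negMulLog (κ.real {k}) / Real.log 2

/-- `H(K | W) = ∫ H(K | W = w) dP_W(w)`, in bits, with `W` arbitrary. -/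
def condShannon [StandardBorelSpace 𝒦] [Nonempty 𝒦] (μ : Measure Ω) [IsFiniteMeasure μ]
    (K : Ω → 𝒦) (W : Ω → 𝒲) : ℝ :=
  ∫ w, shannon (condDistrib K W μ w) ∂(μ.map W)

/-- `I(K; W) = H(K) - H(K | W)`, in bits. -/
def mutualInfo [StandardBorelSpace 𝒦] [Nonempty 𝒦] (μ : Measure Ω) [IsFiniteMeasure μ]
    (K : Ω → 𝒦) (W : Ω → 𝒲) : ℝ :=
  shannon (μ.map K) - condShannon μ K W

/-- The uniformity `log₂ |𝒦| - H(K)`. -/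
def uniformity (μ : Measure Ω) (K : Ω → 𝒦) : ℝ :=
  Real.logb 2 (Fintype.card 𝒦) - shannon (μ.map K)

end Key

end FiniteKey

end

noncomputable section

namespace FiniteKey

/-! ### Shannon entropy of laws on a finite set -/

section Shannon

/-! Put D = k - H(K | G, Zⁿ, F). All entropic claims follow from D < min(εL, εU): since H(K) ≤ k, D
bounds I(K; G Zⁿ F); removing G from the condition only raises the conditional entropy; and
conditioning does not increase entropy, so k - H(K) ≤ D.

The tool is leftover hashing (`le_condShannon_hash`, in the form `sub_condShannon_le`): if p is the
probability that p(xⁿ | zⁿ) ≤ 2^{-a}, then D ≤ (1 - p) k + p log₂(1 + 2^{k + lrec - a} / p). On that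
event the law of ((Zⁿ, F), Xⁿ) has density at most 2^{-a} with respect to a measure whose (Zⁿ,
F)-part has mass |𝓕| ≤ 2^{lrec}. Universality then bounds the mean collision probability, and
tangent lines of the logarithm turn this into a bound on Shannon entropy.

For a = n (H(X|Z) - ε - ε'), write -log p(x|z) = log p(z) - log p(z, x). Two Chernoff tails bound 1
- p (`measure_blockDensity_gt_le`); admissibility bounds the second by 2^{-n b₁ ε}, so 1 - p +
2^{-f} ≤ δ⁽³⁾. `lt_min_of_admissible` has two cases. If δ⁽³⁾ < 1, then p > 2^{-f}, the ratio above
is below 2^{-g}, and D < (1 - p)(k - δ⁽⁴⁾) + δ⁽⁴⁾ ≤ δ⁽⁵⁾. If δ⁽³⁾ ≥ 1, then δ⁽⁵⁾ ≥ k and it suffices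
that D < k strictly. This is `sub_condShannon_lt`: k ≥ 1 forces n H(X|Z) ≥ lrec + 3, and
`exists_rpow_lt_measureReal` supplies another threshold a at which the same hashing bound is below
k.

The supremum is attained because the key lengths are integers bounded above; for k = 0 the claim is
D ≤ 0. -/

theorem measurable_kernel_real {S 𝒦 : Type*} [MeasurableSpace S] [MeasurableSpace 𝒦]
    [MeasurableSingletonClass 𝒦] (η : Kernel S 𝒦) (k : 𝒦) :
    Measurable fun s => (η s).real {k} :=
  (η.measurable_coe (measurableSet_singleton k)).ennreal_toReal

variable {Ω 𝒦 𝒲 : Type*} [MeasurableSpace Ω] [MeasurableSpace 𝒲]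
  [Fintype 𝒦] [MeasurableSpace 𝒦]

theorem shannon_eq_div (κ : Measure 𝒦) :
    shannon κ = (∑ k, Real.negMulLog (κ.real {k})) / Real.log 2 := by
  simp [shannon, Finset.sum_div]

theorem shannon_nonneg (κ : Measure 𝒦) [IsProbabilityMeasure κ] : 0 ≤ shannon κ := by
  refine Finset.sum_nonneg fun k _ => div_nonneg ?_ (Real.log_nonneg (by norm_num))
  exact Real.negMulLog_nonneg measureReal_nonneg measureReal_le_one

/-- Gibbs' inequality against the uniform law: the tangent bound log x ≤ x - 1 leaves an error 1/|𝒦|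
- κ{k} for each k, and these errors sum to zero. -/
theorem shannon_le_logb_card (κ : Measure 𝒦) [MeasurableSingletonClass 𝒦]
    [IsProbabilityMeasure κ] : shannon κ ≤ Real.logb 2 (Fintype.card 𝒦) := by
  have hne : Nonempty 𝒦 := nonempty_of_isProbabilityMeasure κ
  have hM : (0 : ℝ) < Fintype.card 𝒦 := by exact_mod_cast Fintype.card_pos
  have hsum : ∑ k, κ.real {k} = 1 := by
    rw [sum_measureReal_singleton, Finset.coe_univ, probReal_univ]
  rw [shannon_eq_div, Real.logb]
  refine div_le_div_of_nonneg_right ?_ (Real.log_nonneg (by norm_num))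
  have key : ∀ k, Real.negMulLog (κ.real {k})
      ≤ κ.real {k} * Real.log (Fintype.card 𝒦) + ((Fintype.card 𝒦 : ℝ)⁻¹ - κ.real {k}) := by
    intro k
    rcases (measureReal_nonneg : 0 ≤ κ.real {k}).eq_or_lt with h | h
    · rw [← h]; simp
    · have h1 := Real.log_le_sub_one_of_pos (x := (κ.real {k} * Fintype.card 𝒦)⁻¹) (by positivity)
      rw [Real.log_inv, Real.log_mul h.ne' hM.ne'] at h1
      have h2 := mul_le_mul_of_nonneg_left h1 h.le
      have h3 : κ.real {k} * ((κ.real {k} * Fintype.card 𝒦)⁻¹ - 1)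
          = (Fintype.card 𝒦 : ℝ)⁻¹ - κ.real {k} := by field_simp
      rw [h3] at h2
      rw [Real.negMulLog]
      linarith
  refine (Finset.sum_le_sum fun k _ => key k).trans ?_
  rw [Finset.sum_add_distrib, ← Finset.sum_mul, Finset.sum_sub_distrib, hsum]
  simp [hM.ne']

theorem abs_shannon_le (κ : Measure 𝒦) [MeasurableSingletonClass 𝒦] [IsProbabilityMeasure κ] :
    ‖shannon κ‖ ≤ Real.logb 2 (Fintype.card 𝒦) := by
  rw [Real.norm_eq_abs, abs_of_nonneg (shannon_nonneg κ)]
  exact shannon_le_logb_card κ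

theorem measurable_shannon_kernel {S : Type*} [MeasurableSpace S] [MeasurableSingletonClass 𝒦]
    (η : Kernel S 𝒦) : Measurable fun s => shannon (η s) := by
  unfold shannon
  refine Finset.measurable_sum _ fun k _ => ?_
  exact (Real.continuous_negMulLog.measurable.comp (measurable_kernel_real η k)).div_const _

theorem integrable_shannon_kernel {S : Type*} [MeasurableSpace S] [MeasurableSingletonClass 𝒦]
    (τ : Measure S) [IsFiniteMeasure τ] (η : Kernel S 𝒦) [IsMarkovKernel η] :
    Integrable (fun s => shannon (η s)) τ :=
  Integrable.of_bound (measurable_shannon_kernel η).aestronglyMeasurable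
    (Real.logb 2 (Fintype.card 𝒦)) (ae_of_all _ fun s => abs_shannon_le (η s))

/-- Concavity of the Shannon entropy: mixing laws does not decrease the entropy. -/
theorem integral_shannon_le {S : Type*} [MeasurableSpace S] [MeasurableSingletonClass 𝒦]
    (τ : Measure S) [IsProbabilityMeasure τ] (η : Kernel S 𝒦) [IsMarkovKernel η]
    (ρ : Measure 𝒦) (hρ : ∀ k, ρ {k} = ∫⁻ s, η s {k} ∂τ) :
    ∫ s, shannon (η s) ∂τ ≤ shannon ρ := by
  have hlog : (0 : ℝ) ≤ Real.log 2 := Real.log_nonneg (by norm_num)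
  have hint : ∀ k, Integrable (fun s => (η s).real {k}) τ := fun k =>
    Integrable.of_bound (measurable_kernel_real η k).aestronglyMeasurable 1
      (ae_of_all _ fun s => by
        rw [Real.norm_eq_abs, abs_of_nonneg measureReal_nonneg]; exact measureReal_le_one)
  have hint' : ∀ k, Integrable (fun s => Real.negMulLog ((η s).real {k})) τ := fun k =>
    Integrable.of_bound
      (Real.continuous_negMulLog.measurable.comp (measurable_kernel_real η k)).aestronglyMeasurable 1
      (ae_of_all _ fun s => by
        have h0 : 0 ≤ (η s).real {k} := measureReal_nonneg
        have h1 : (η s).real {k} ≤ 1 := measureReal_le_one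
        have h2 := Real.negMulLog_nonneg h0 h1
        rw [Real.norm_eq_abs, abs_of_nonneg h2]
        exact (Real.negMulLog_le_one_sub_self h0).trans (by linarith))
  have hreal : ∀ k, ρ.real {k} = ∫ s, (η s).real {k} ∂τ := fun k => by
    rw [measureReal_def, hρ k, ← integral_toReal
      (η.measurable_coe (measurableSet_singleton k)).aemeasurable
      (ae_of_all _ fun s => measure_lt_top _ _)]
    rfl
  unfold shannon
  rw [integral_finsetSum _ fun k _ => (hint' k).div_const _]
  refine Finset.sum_le_sum fun k _ => ?_
  rw [integral_div, hreal k]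
  refine div_le_div_of_nonneg_right ?_ hlog
  exact Real.concaveOn_negMulLog.le_map_integral Real.continuous_negMulLog.continuousOn
    isClosed_Ici (ae_of_all _ fun s => measureReal_nonneg) (hint k) (hint' k)

variable [StandardBorelSpace 𝒦] [Nonempty 𝒦] (μ : Measure Ω) [IsProbabilityMeasure μ]
  {K : Ω → 𝒦} {W : Ω → 𝒲}

theorem condShannon_nonneg : 0 ≤ condShannon μ K W :=
  integral_nonneg fun _ => shannon_nonneg _

/-- Conditioning does not increase the entropy. -/
theorem condShannon_le_shannon (hK : Measurable K) (hW : Measurable W) :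
    condShannon μ K W ≤ shannon (μ.map K) := by
  have := Measure.isProbabilityMeasure_map (μ := μ) hW.aemeasurable
  refine integral_shannon_le (μ.map W) (condDistrib K W μ) _ fun k => ?_
  have h := congrArg (fun ν : Measure (𝒲 × 𝒦) => ν (Set.univ ×ˢ {k}))
    (compProd_map_condDistrib (X := W) (Y := K) (μ := μ) hK.aemeasurable)
  rw [Measure.compProd_apply_prod MeasurableSet.univ (measurableSet_singleton k),
    Measure.map_apply (hW.prodMk hK) (MeasurableSet.univ.prod (measurableSet_singleton k)),
    setLIntegral_univ] at h
  rw [h, Measure.map_apply hK (measurableSet_singleton k)]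
  congr 1
  ext ω; simp

/-- Conditioning on an additional independent variable does not increase the entropy. -/
theorem condShannon_prodMk_le {𝒮 : Type*} [MeasurableSpace 𝒮] {G : Ω → 𝒮}
    (hK : Measurable K) (hW : Measurable W) (hG : Measurable G) (hind : IndepFun G W μ) :
    condShannon μ K (fun ω => (G ω, W ω)) ≤ condShannon μ K W := by
  have hσ := Measure.isProbabilityMeasure_map (μ := μ) hG.aemeasurable
  have hm := Measure.isProbabilityMeasure_map (μ := μ) hW.aemeasurable
  have hprod := (indepFun_iff_map_prod_eq_prod_map_map hG.aemeasurable hW.aemeasurable).1 hind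
  set σ := μ.map G with hσdef
  set m := μ.map W with hmdef
  set κ := condDistrib K (fun ω => (G ω, W ω)) μ with hκ
  -- The conditional law given (G, W), averaged over the seed. As G and W are independent, this
  -- average is a version of the conditional law of K given W alone, and concavity applies for each
  -- value of W.
  let η : Kernel 𝒲 𝒦 := κ ∘ₖ (Kernel.const 𝒲 σ ×ₖ Kernel.id)
  have hη : ∀ v, ∀ C, MeasurableSet C → η v C = ∫⁻ g, κ (g, v) C ∂σ := by
    intro v C hC
    have hmeas : Measurable fun p : 𝒮 × 𝒲 => κ p C := κ.measurable_coe hC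
    rw [Kernel.comp_apply' _ _ _ hC, Kernel.prod_apply, Kernel.const_apply, Kernel.id_apply,
      lintegral_prod _ hmeas.aemeasurable]
    exact lintegral_congr fun g => lintegral_dirac' v (hmeas.comp measurable_prodMk_left)
  have hlaw : μ.map (fun ω => (W ω, K ω)) = m ⊗ₘ η := by
    refine Measure.ext_prod fun {B C} hB hC => ?_
    have hmeas : Measurable fun p : 𝒮 × 𝒲 => κ p C := κ.measurable_coe hC
    rw [Measure.compProd_apply_prod hB hC]
    simp_rw [hη _ C hC]
    have h := congrArg (fun ν : Measure ((𝒮 × 𝒲) × 𝒦) => ν ((Set.univ ×ˢ B) ×ˢ C))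
      (compProd_map_condDistrib (X := fun ω => (G ω, W ω)) (Y := K) (μ := μ) hK.aemeasurable)
    rw [Measure.compProd_apply_prod (MeasurableSet.univ.prod hB) hC, hprod, ← hκ,
      ← Measure.prod_restrict, Measure.restrict_univ, lintegral_prod_symm _ hmeas.aemeasurable,
      Measure.map_apply ((hG.prodMk hW).prodMk hK) ((MeasurableSet.univ.prod hB).prod hC)] at h
    rw [h, Measure.map_apply (hW.prodMk hK) (hB.prod hC)]
    congr 1
    ext ω; simp
  have hae := condDistrib_ae_eq_of_measure_eq_compProd (μ := μ) W hK.aemeasurable hlaw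
  unfold condShannon
  rw [hprod, ← hκ, integral_prod_symm _ (integrable_shannon_kernel (σ.prod m) κ)]
  have hint : Integrable (fun p : 𝒮 × 𝒲 => shannon (κ p)) (σ.prod m) :=
    integrable_shannon_kernel (σ.prod m) κ
  refine integral_mono_ae hint.integral_prod_right
    (integrable_shannon_kernel m (condDistrib K W μ)) ?_
  filter_upwards [hae] with v hv
  refine integral_shannon_le σ (κ.comap (fun g => (g, v)) measurable_prodMk_right) _ fun k => ?_
  rw [hv, hη v _ (measurableSet_singleton k)]
  rfl

end Shannon

/-! ### Leftover hashing -/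

section Hash

variable {A 𝒮 𝒦 : Type*} [MeasurableSpace A] [Countable A] [DiscreteMeasurableSpace A]
  [MeasurableSpace 𝒮] [Fintype 𝒦] [MeasurableSpace 𝒦]

theorem IsUniversal₂.measurable_uncurry {σ : Measure 𝒮} {h : 𝒮 → A → 𝒦}
    (hh : IsUniversal₂ σ h) : Measurable fun p : 𝒮 × A => h p.1 p.2 :=
  measurable_from_prod_countable_left fun x => hh.measurable x

variable [MeasurableSingletonClass 𝒦]

/-- The average collision probability of a universal₂ hash function. -/
theorem IsUniversal₂.lintegral_sum_sq_le {σ : Measure 𝒮} [IsProbabilityMeasure σ]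
    {h : 𝒮 → A → 𝒦} (hh : IsUniversal₂ σ h) (τ : Measure A) [IsFiniteMeasure τ] :
    ∫⁻ g, ∑ k, τ {x | h g x = k} ^ 2 ∂σ
      ≤ ∫⁻ x, τ {x} ∂τ + (Fintype.card 𝒦 : ℝ≥0∞)⁻¹ * τ Set.univ ^ 2 := by
  have hm := hh.measurable_uncurry
  have hset : MeasurableSet {q : (𝒮 × A) × A | h q.1.1 q.2 = h q.1.1 q.1.2} :=
    measurableSet_eq_fun
      (hm.comp ((measurable_fst.comp measurable_fst).prodMk measurable_snd))
      (hm.comp ((measurable_fst.comp measurable_fst).prodMk (measurable_snd.comp measurable_fst)))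
  -- For a fixed seed the sum of squares is the mass of colliding pairs under τ × τ. After swapping
  -- the integrals, the diagonal gives τ {x} and universality handles all other pairs.
  have h1 : ∀ g, ∑ k, τ {x | h g x = k} ^ 2 = ∫⁻ x, τ {x' | h g x' = h g x} ∂τ := by
    intro g
    have hg : Measurable (h g) := Measurable.of_discrete
    have : ∫⁻ x, τ {x' | h g x' = h g x} ∂τ = ∫⁻ k, τ {x' | h g x' = k} ∂(τ.map (h g)) := by
      rw [lintegral_map (measurable_of_finite _) hg]
    rw [this, lintegral_fintype]
    refine Finset.sum_congr rfl fun k _ => ?_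
    rw [Measure.map_apply hg (measurableSet_singleton k), sq]
    rfl
  have h2 : Measurable fun p : 𝒮 × A => τ {x' | h p.1 x' = h p.1 p.2} :=
    measurable_measure_prodMk_left hset
  simp_rw [h1]
  rw [lintegral_lintegral_swap (f := fun g x => τ {x' | h g x' = h g x}) h2.aemeasurable]
  have h3 : ∀ x, ∫⁻ g, τ {x' | h g x' = h g x} ∂σ
      ≤ τ {x} + (Fintype.card 𝒦 : ℝ≥0∞)⁻¹ * τ Set.univ := by
    intro x
    have hs : MeasurableSet {p : 𝒮 × A | h p.1 p.2 = h p.1 x} :=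
      measurableSet_eq_fun hm (hm.comp (measurable_fst.prodMk measurable_const))
    have e1 : ∫⁻ g, τ {x' | h g x' = h g x} ∂σ = (σ.prod τ) {p : 𝒮 × A | h p.1 p.2 = h p.1 x} := by
      rw [Measure.prod_apply hs]; rfl
    rw [e1, Measure.prod_apply_symm hs]
    calc ∫⁻ x', σ ((fun g => (g, x')) ⁻¹' {p : 𝒮 × A | h p.1 p.2 = h p.1 x}) ∂τ
        ≤ ∫⁻ x', (Set.indicator {x} 1 x' + (Fintype.card 𝒦 : ℝ≥0∞)⁻¹) ∂τ := by
          refine lintegral_mono fun x' => ?_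
          by_cases hx : x' = x
          · subst hx
            simp only [Set.mem_singleton_iff, Set.indicator_of_mem, Pi.one_apply]
            exact prob_le_one.trans le_self_add
          · exact (hh.collision x' x hx).trans le_add_self
      _ = τ {x} + (Fintype.card 𝒦 : ℝ≥0∞)⁻¹ * τ Set.univ := by
          rw [lintegral_add_right _ measurable_const,
            lintegral_indicator_one (measurableSet_singleton x), lintegral_const]
  refine (lintegral_mono h3).trans ?_
  rw [lintegral_add_right _ measurable_const, lintegral_const, sq, mul_assoc]

end Hash

/-- A lower bound for the entropy of a finite law that is linear in the squares of a part of it. -/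
theorem negMulLog_ge_of_le {a P α b : ℝ} (ha : 0 ≤ a) (haP : a ≤ P) (haα : a ≤ α)
    (hP : P ≤ 1) (hb : 0 < b) :
    a * (1 - Real.log b) - a ^ 2 / α / b + (a - α * P) ≤ Real.negMulLog P := by
  rcases ha.eq_or_lt with rfl | ha'
  · have := Real.negMulLog_nonneg haP hP
    have h2 : 0 ≤ α * P := mul_nonneg haα haP
    simp only [zero_mul, zero_sub]
    norm_num
    linarith
  · have hα := ha'.trans_le haα
    have hPp := ha'.trans_le haP
    have h1 : -Real.log P * a ≤ Real.negMulLog P := by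
      rw [Real.negMulLog]
      nlinarith [mul_nonneg (sub_nonneg.2 haP) (neg_nonneg.2 (Real.log_nonpos hPp.le hP))]
    -- Two tangent lines, applied to the splitting log P = log (a / (α b)) + log b + log (α P / a).
    -- The second leaves a - α P, which vanishes when summed over the keys.
    have h2 := Real.log_le_sub_one_of_pos (x := a / (α * b)) (by positivity)
    have h3 := Real.log_le_sub_one_of_pos (x := α * P / a) (by positivity)
    rw [Real.log_div ha'.ne' (by positivity), Real.log_mul hα.ne' hb.ne'] at h2
    rw [Real.log_div (by positivity) ha'.ne', Real.log_mul hα.ne' hPp.ne'] at h3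
    have h4 : Real.log P ≤ a / (α * b) - 1 + Real.log b + (α * P / a - 1) := by linarith
    have h5 := mul_le_mul_of_nonneg_right h4 ha'.le
    have e : (a / (α * b) - 1 + Real.log b + (α * P / a - 1)) * a
        = a ^ 2 / α / b - a + Real.log b * a + (α * P - a) := by
      field_simp
    rw [e] at h5
    linarith

section Leftover

variable {Ω A 𝒱 𝒮 𝒦 : Type*} [MeasurableSpace Ω] [MeasurableSpace A] [Countable A]
  [DiscreteMeasurableSpace A] [Nonempty A] [MeasurableSpace 𝒱] [MeasurableSpace 𝒮]
  [MeasurableSpace 𝒦] [StandardBorelSpace 𝒦]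
  (μ : Measure Ω) [IsProbabilityMeasure μ] {X : Ω → A} {V : Ω → 𝒱} {G : Ω → 𝒮}

/-- The conditional law of the hash of `X` given the seed and the side information. -/
theorem condDistrib_hash_ae_eq [Nonempty 𝒦] (hX : Measurable X) (hV : Measurable V) (hG : Measurable G)
    (hind : IndepFun G (fun ω => (V ω, X ω)) μ) {h : 𝒮 → A → 𝒦}
    (hm : Measurable fun p : 𝒮 × A => h p.1 p.2) :
    ∀ᵐ w ∂(μ.map fun ω => (G ω, V ω)), ∀ C : Set 𝒦, MeasurableSet C →
      condDistrib (fun ω => h (G ω) (X ω)) (fun ω => (G ω, V ω)) μ w C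
        = condDistrib X V μ w.2 {x | h w.1 x ∈ C} := by
  have hσ := Measure.isProbabilityMeasure_map (μ := μ) hG.aemeasurable
  have hmV := Measure.isProbabilityMeasure_map (μ := μ) hV.aemeasurable
  set κ := condDistrib X V μ with hκ
  -- Candidate for the conditional law: freeze the seed, draw X from its conditional law given V,
  -- and hash. Independence of G from (V, X) gives it the right joint law, and conditional laws are
  -- a.e. unique.
  let η : Kernel (𝒮 × 𝒱) 𝒦 :=
    ((Kernel.deterministic Prod.fst measurable_fst) ×ₖ (κ.comap Prod.snd measurable_snd)).map
      (fun p : 𝒮 × A => h p.1 p.2)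
  have hη : ∀ w, ∀ C, MeasurableSet C → η w C = κ w.2 {x | h w.1 x ∈ C} := by
    intro w C hC
    rw [Kernel.map_apply' _ hm _ hC, Kernel.prod_apply, Kernel.deterministic_apply,
      Kernel.comap_apply, Measure.dirac_prod, Measure.map_apply measurable_prodMk_left (hm hC)]
    rfl
  have : IsMarkovKernel η := Kernel.IsMarkovKernel.map _ hm
  have hGV : IndepFun G V μ := hind.comp measurable_id measurable_fst
  have hprod := (indepFun_iff_map_prod_eq_prod_map_map hG.aemeasurable hV.aemeasurable).1 hGV
  have hprod' := (indepFun_iff_map_prod_eq_prod_map_map hG.aemeasurable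
    (hV.prodMk hX).aemeasurable).1 hind
  have hKm : Measurable fun ω => h (G ω) (X ω) := hm.comp (hG.prodMk hX)
  have hlaw : μ.map (fun ω => ((G ω, V ω), h (G ω) (X ω)))
      = μ.map (fun ω => (G ω, V ω)) ⊗ₘ η := by
    refine Measure.ext fun S hS => ?_
    have hφ : Measurable fun q : 𝒮 × (𝒱 × A) => ((q.1, q.2.1), h q.1 q.2.2) := by
      refine (measurable_fst.prodMk (measurable_fst.comp measurable_snd)).prodMk ?_
      exact hm.comp (measurable_fst.prodMk (measurable_snd.comp measurable_snd))
    have e1 : μ.map (fun ω => ((G ω, V ω), h (G ω) (X ω)))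
        = (μ.map fun ω => (G ω, (V ω, X ω))).map
          (fun q : 𝒮 × (𝒱 × A) => ((q.1, q.2.1), h q.1 q.2.2)) := by
      rw [Measure.map_map hφ (hG.prodMk (hV.prodMk hX))]; rfl
    rw [e1, Measure.map_apply hφ hS, hprod', Measure.prod_apply (hφ hS),
      Measure.compProd_apply hS, hprod,
      lintegral_prod _ (Kernel.measurable_kernel_prodMk_left hS).aemeasurable]
    refine lintegral_congr fun g => ?_
    rw [← compProd_map_condDistrib hX.aemeasurable,
      Measure.compProd_apply (measurable_prodMk_left (hφ hS))]
    refine lintegral_congr fun v => ?_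
    rw [hη _ _ (measurable_prodMk_left hS)]
    rfl
  filter_upwards [condDistrib_ae_eq_of_measure_eq_compProd (μ := μ) (fun ω => (G ω, V ω))
    hKm.aemeasurable hlaw] with w hw C hC
  rw [hw, hη w C hC]

/-- The average of the squared conditional hash probabilities on `T`, weighted by the conditional
probability of `T`. -/
theorem lintegral_sum_sq_div_le [Fintype 𝒦] (hX : Measurable X) (hV : Measurable V)
    {σ : Measure 𝒮} [IsProbabilityMeasure σ] {h : 𝒮 → A → 𝒦} (hh : IsUniversal₂ σ h)
    {T : Set (𝒱 × A)} (hT : MeasurableSet T) {ρ : Measure 𝒱} [SFinite ρ] {c : ℝ≥0∞}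
    (hle : (μ.map fun ω => (V ω, X ω)).restrict T ≤ c • ρ.prod Measure.count) :
    ∫⁻ v, ∫⁻ g, ∑ k, ((condDistrib X V μ v).restrict (Prod.mk v ⁻¹' T)) {x | h g x = k} ^ 2
        / condDistrib X V μ v (Prod.mk v ⁻¹' T) ∂σ ∂(μ.map V)
      ≤ c * ρ Set.univ
        + (Fintype.card 𝒦 : ℝ≥0∞)⁻¹ * (μ.map fun ω => (V ω, X ω)) T := by
  have hmV := Measure.isProbabilityMeasure_map (μ := μ) hV.aemeasurable
  set κ := condDistrib X V μ with hκ
  set m := μ.map V with hm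
  have hlaw : m ⊗ₘ κ = μ.map fun ω => (V ω, X ω) := compProd_map_condDistrib hX.aemeasurable
  let τ : 𝒱 → Measure A := fun v => (κ v).restrict (Prod.mk v ⁻¹' T)
  let α : 𝒱 → ℝ≥0∞ := fun v => κ v (Prod.mk v ⁻¹' T)
  have hτα : ∀ v, τ v Set.univ = α v := fun v => Measure.restrict_apply_univ _
  have hα1 : ∀ v, α v ≤ 1 := fun v => prob_le_one
  have hαm : Measurable α := Kernel.measurable_kernel_prodMk_left hT
  have hτm : Measurable fun q : 𝒱 × A => τ q.1 {q.2} := by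
    refine measurable_from_prod_countable_left fun x => ?_
    have : (fun v => τ v {x}) = fun v => κ v (Prod.mk v ⁻¹' (T ∩ Set.univ ×ˢ {x})) := by
      funext v
      rw [Measure.restrict_apply (measurableSet_singleton x)]
      congr 1
      ext y; simp [and_comm]
    rw [this]
    exact Kernel.measurable_kernel_prodMk_left
      (hT.inter (MeasurableSet.univ.prod (measurableSet_singleton x)))
  -- The collision bound for the part of the conditional law on T, of total mass α v. Division by α
  -- v turns the squared mass in the universality term into α v; where α v = 0, the quotient 0 / 0
  -- is 0.
  have hpt : ∀ v, ∫⁻ g, ∑ k, τ v {x | h g x = k} ^ 2 / α v ∂σ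
      ≤ ∫⁻ x in Prod.mk v ⁻¹' T, τ v {x} / α v ∂κ v + (Fintype.card 𝒦 : ℝ≥0∞)⁻¹ * α v := by
    intro v
    by_cases h0 : α v = 0
    · have hz : ∀ S, τ v S = 0 := fun S =>
        le_antisymm ((measure_mono (Set.subset_univ S)).trans ((hτα v).trans h0).le) zero_le
      simp [hz]
    · have htop : (α v)⁻¹ ≠ ⊤ := ENNReal.inv_ne_top.2 h0
      simp_rw [div_eq_mul_inv, ← Finset.sum_mul]
      rw [lintegral_mul_const' _ _ htop]
      refine (mul_le_mul_left (hh.lintegral_sum_sq_le (τ v)) _).trans ?_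
      rw [add_mul, lintegral_mul_const' _ _ htop, hτα, mul_assoc, sq, mul_assoc (α v),
        ENNReal.mul_inv_cancel h0 ((hα1 v).trans_lt ENNReal.one_lt_top).ne, mul_one]
  calc ∫⁻ v, ∫⁻ g, ∑ k, τ v {x | h g x = k} ^ 2 / α v ∂σ ∂m
      ≤ ∫⁻ v, (∫⁻ x in Prod.mk v ⁻¹' T, τ v {x} / α v ∂κ v
          + (Fintype.card 𝒦 : ℝ≥0∞)⁻¹ * α v) ∂m := lintegral_mono hpt
    _ = ∫⁻ v, ∫⁻ x in Prod.mk v ⁻¹' T, τ v {x} / α v ∂κ v ∂m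
          + (Fintype.card 𝒦 : ℝ≥0∞)⁻¹ * (μ.map fun ω => (V ω, X ω)) T := by
        rw [lintegral_add_right _ (hαm.const_mul _), lintegral_const_mul _ hαm, ← hlaw,
          Measure.compProd_apply hT]
    _ ≤ _ := by
        gcongr
        have hF : Measurable fun q : 𝒱 × A => τ q.1 {q.2} / α q.1 :=
          hτm.div (hαm.comp measurable_fst)
        have e : ∫⁻ v, ∫⁻ x in Prod.mk v ⁻¹' T, τ v {x} / α v ∂κ v ∂m
            = ∫⁻ q in T, τ q.1 {q.2} / α q.1 ∂(m ⊗ₘ κ) := by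
          rw [← lintegral_indicator hT, Measure.lintegral_compProd (hF.indicator hT)]
          refine lintegral_congr fun v => ?_
          rw [← lintegral_indicator (measurable_prodMk_left hT)]
          rfl
        rw [e, hlaw]
        refine (lintegral_mono' hle le_rfl).trans ?_
        rw [lintegral_smul_measure, smul_eq_mul]
        gcongr
        rw [lintegral_prod _ hF.aemeasurable]
        -- Once the joint law is dominated by c times ρ × counting measure, the diagonal term only
        -- sums the normalized masses τ v {x} / α v, which total at most 1 for each v.
        calc ∫⁻ v, ∫⁻ x, τ v {x} / α v ∂Measure.count ∂ρ ≤ ∫⁻ _, 1 ∂ρ := by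
              refine lintegral_mono fun v => ?_
              simp_rw [div_eq_mul_inv]
              rw [lintegral_mul_const _ (measurable_of_countable _), lintegral_count]
              have : ∑' x, τ v {x} = α v := by
                rw [← hτα v, ← Set.iUnion_of_singleton A,
                  measure_iUnion (fun i j hij => by simpa using hij)
                    (fun i => measurableSet_singleton i)]
              rw [this]
              exact ENNReal.mul_inv_le_one _
          _ = ρ Set.univ := lintegral_one

/-- **Leftover hashing**: a lower bound for the entropy of the hash of `X` given the seed and the
side information `V`, if the joint law of `(V, X)` has a small density on `T`. -/
theorem le_condShannon_hash [Fintype 𝒦] [Nonempty 𝒦] (hX : Measurable X) (hV : Measurable V)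
    (hG : Measurable G)
    (hind : IndepFun G (fun ω => (V ω, X ω)) μ) {h : 𝒮 → A → 𝒦}
    (hh : IsUniversal₂ (μ.map G) h)
    {T : Set (𝒱 × A)} (hT : MeasurableSet T) {ρ : Measure 𝒱} [IsFiniteMeasure ρ] {c : ℝ≥0∞}
    (hc : c ≠ ⊤)
    (hle : (μ.map fun ω => (V ω, X ω)).restrict T ≤ c • ρ.prod Measure.count)
    (hpos : 0 < (μ.map fun ω => (V ω, X ω)).real T) :
    -((μ.map fun ω => (V ω, X ω)).real T * Real.logb 2 ((Fintype.card 𝒦 : ℝ)⁻¹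
        + c.toReal * ρ.real Set.univ / (μ.map fun ω => (V ω, X ω)).real T))
      ≤ condShannon μ (fun ω => h (G ω) (X ω)) (fun ω => (G ω, V ω)) := by
  have hσ := Measure.isProbabilityMeasure_map (μ := μ) hG.aemeasurable
  have hmV := Measure.isProbabilityMeasure_map (μ := μ) hV.aemeasurable
  have hGV : IndepFun G V μ := hind.comp measurable_id measurable_fst
  have hprod := (indepFun_iff_map_prod_eq_prod_map_map hG.aemeasurable hV.aemeasurable).1 hGV
  have hlaw : μ.map V ⊗ₘ condDistrib X V μ = μ.map fun ω => (V ω, X ω) :=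
    compProd_map_condDistrib hX.aemeasurable
  have hqle := lintegral_sum_sq_div_le μ hX hV hh hT hle
  have hdist := condDistrib_hash_ae_eq μ hX hV hG hind hh.measurable_uncurry
  have hum := hh.measurable_uncurry
  set σ := μ.map G
  set m := μ.map V
  set κ := condDistrib X V μ with hκ
  set Q := μ.map fun ω => (V ω, X ω) with hQ
  have hQp : IsProbabilityMeasure Q :=
    Measure.isProbabilityMeasure_map (μ := μ) (hV.prodMk hX).aemeasurable
  set p := Q.real T with hp
  set R := ρ.real Set.univ with hR
  set M : ℝ := (Fintype.card 𝒦 : ℝ) with hMdef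
  have hM : 0 < M := by simp only [hMdef]; exact_mod_cast Fintype.card_pos
  -- The tangent point: p b is exactly the bound on the mean of ∑ a² / α, so the linear term costs
  -- at most p and only -p log b remains.
  set b := M⁻¹ + c.toReal * R / p with hb
  have hR0 : 0 ≤ R := measureReal_nonneg
  have hb0 : 0 < b := by
    have : 0 ≤ c.toReal * R / p := by positivity
    have : 0 < M⁻¹ := by positivity
    linarith
  let κ' : Kernel (𝒮 × 𝒱) A := κ.comap Prod.snd measurable_snd
  let α : 𝒮 × 𝒱 → ℝ≥0∞ := fun w => κ w.2 (Prod.mk w.2 ⁻¹' T)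
  let a : 𝒦 → 𝒮 × 𝒱 → ℝ≥0∞ := fun k w =>
    ((κ w.2).restrict (Prod.mk w.2 ⁻¹' T)) {x | h w.1 x = k}
  have hαm : Measurable α := (Kernel.measurable_kernel_prodMk_left hT).comp measurable_snd
  have hmem : ∀ (w : 𝒮 × 𝒱) (S : Set A), MeasurableSet S := fun _ S => MeasurableSet.of_discrete
  have ham : ∀ k, Measurable (a k) := by
    intro k
    have hS : MeasurableSet {q : (𝒮 × 𝒱) × A | h q.1.1 q.2 = k ∧ (q.1.2, q.2) ∈ T} := by
      refine MeasurableSet.inter ?_ ?_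
      · exact (hum.comp ((measurable_fst.comp measurable_fst).prodMk measurable_snd))
          (measurableSet_singleton k)
      · exact ((measurable_snd.comp measurable_fst).prodMk measurable_snd) hT
    have e : a k = fun w => κ' w (Prod.mk w ⁻¹'
        {q : (𝒮 × 𝒱) × A | h q.1.1 q.2 = k ∧ (q.1.2, q.2) ∈ T}) := by
      funext w
      simp only [a, κ']
      rw [Measure.restrict_apply (hmem w _), Kernel.comap_apply]
      rfl
    rw [e]
    exact Kernel.measurable_kernel_prodMk_left hS
  have haα : ∀ k w, a k w ≤ α w := fun k w => by
    simp only [a, α]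
    rw [Measure.restrict_apply (hmem w _)]
    exact measure_mono Set.inter_subset_right
  have hα1 : ∀ w, α w ≤ 1 := fun w => prob_le_one
  have hαt : ∀ w, α w ≠ ⊤ := fun w => ((hα1 w).trans_lt ENNReal.one_lt_top).ne
  have hat : ∀ k w, a k w ≠ ⊤ := fun k w => ((haα k w).trans_lt (hαt w).lt_top).ne
  have hsuma : ∀ w, ∑ k, a k w = α w := by
    intro w
    have hg : Measurable (h w.1) := Measurable.of_discrete
    have : ∀ k, a k w = (((κ w.2).restrict (Prod.mk w.2 ⁻¹' T)).map (h w.1)) {k} := fun k => by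
      rw [Measure.map_apply hg (measurableSet_singleton k)]; rfl
    simp_rw [this]
    rw [sum_measure_singleton, Finset.coe_univ, Measure.map_apply hg MeasurableSet.univ,
      Set.preimage_univ, Measure.restrict_apply_univ]
  have hqm : Measurable fun w => ∑ k, a k w ^ 2 / α w :=
    Finset.measurable_sum _ fun k _ => ((ham k).pow_const 2).div hαm
  have hq1 : ∀ k w, a k w ^ 2 / α w ≤ 1 := fun k w => by
    refine ENNReal.div_le_of_le_mul ?_
    rw [one_mul, sq]
    calc a k w * a k w ≤ α w * 1 := mul_le_mul' (haα k w) ((haα k w).trans (hα1 w))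
      _ = α w := mul_one _
  have hqt : ∀ w, ∑ k, a k w ^ 2 / α w ≠ ⊤ := fun w =>
    ENNReal.sum_ne_top.2 fun k _ => ((hq1 k w).trans_lt ENNReal.one_lt_top).ne
  have hqint : ∫⁻ w, ∑ k, a k w ^ 2 / α w ∂(σ.prod m) ≤ c * ρ Set.univ
      + (Fintype.card 𝒦 : ℝ≥0∞)⁻¹ * Q T := by
    rw [lintegral_prod_symm _ hqm.aemeasurable]
    exact hqle
  have hbound : c * ρ Set.univ + (Fintype.card 𝒦 : ℝ≥0∞)⁻¹ * Q T ≠ ⊤ := by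
    refine ENNReal.add_ne_top.2 ⟨ENNReal.mul_ne_top hc (measure_ne_top _ _),
      ENNReal.mul_ne_top ?_ (measure_ne_top _ _)⟩
    simp [Fintype.card_ne_zero]
  have hqreal : ∫ w, (∑ k, a k w ^ 2 / α w).toReal ∂(σ.prod m) ≤ p * b := by
    rw [integral_toReal hqm.aemeasurable (ae_of_all _ fun w => (hqt w).lt_top)]
    refine (ENNReal.toReal_mono hbound hqint).trans_eq ?_
    rw [ENNReal.toReal_add (ENNReal.add_ne_top.1 hbound).1 (ENNReal.add_ne_top.1 hbound).2,
      ENNReal.toReal_mul, ENNReal.toReal_mul, ENNReal.toReal_inv, ENNReal.toReal_natCast]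
    change c.toReal * R + M⁻¹ * p = p * (M⁻¹ + c.toReal * R / p)
    field_simp
    ring
  have hαreal : ∫ w, (α w).toReal ∂(σ.prod m) = p := by
    rw [integral_toReal hαm.aemeasurable (ae_of_all _ fun w => (hαt w).lt_top),
      lintegral_prod_symm _ hαm.aemeasurable]
    simp only [α, lintegral_const, measure_univ, mul_one]
    rw [hp, measureReal_def, ← hlaw, Measure.compProd_apply hT]
  have hαi : Integrable (fun w => (α w).toReal) (σ.prod m) :=
    Integrable.of_bound hαm.ennreal_toReal.aestronglyMeasurable 1 (ae_of_all _ fun w => by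
      rw [Real.norm_eq_abs, abs_of_nonneg ENNReal.toReal_nonneg]
      exact ENNReal.toReal_le_of_le_ofReal zero_le_one (by simpa using hα1 w))
  have hqi : Integrable (fun w => (∑ k, a k w ^ 2 / α w).toReal) (σ.prod m) :=
    integrable_toReal_of_lintegral_ne_top hqm.aemeasurable
      (hqint.trans_lt hbound.lt_top).ne
  have hlog : 0 < Real.log 2 := Real.log_pos (by norm_num)
  have hkey : p * (1 - Real.log b) - p ≤ Real.log 2 *
      condShannon μ (fun ω => h (G ω) (X ω)) (fun ω => (G ω, V ω)) := by
    unfold condShannon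
    rw [hprod, ← integral_const_mul]
    have hI : Integrable (fun w => (α w).toReal * (1 - Real.log b)
        - (∑ k, a k w ^ 2 / α w).toReal / b) (σ.prod m) := (hαi.mul_const _).sub (hqi.div_const _)
    have hJ : ∫ w, ((α w).toReal * (1 - Real.log b)
        - (∑ k, a k w ^ 2 / α w).toReal / b) ∂(σ.prod m) ≥ p * (1 - Real.log b) - p := by
      rw [integral_sub (hαi.mul_const _) (hqi.div_const _), integral_mul_const, integral_div,
        hαreal]
      have : (∫ w, (∑ k, a k w ^ 2 / α w).toReal ∂(σ.prod m)) / b ≤ p := by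
        rw [div_le_iff₀ hb0]; exact hqreal
      linarith
    refine hJ.le.trans (integral_mono_ae hI
      ((integrable_shannon_kernel _ _).const_mul _) ?_)
    rw [hprod] at hdist
    filter_upwards [hdist] with w hw
    have hP : ∀ k, (condDistrib (fun ω => h (G ω) (X ω)) (fun ω => (G ω, V ω)) μ w).real {k}
        = (κ w.2).real {x | h w.1 x = k} := fun k => by
      rw [measureReal_def, hw {k} (measurableSet_singleton k)]; rfl
    have hPsum : ∑ k, (κ w.2).real {x | h w.1 x = k} = 1 := by
      simp_rw [← hP]
      rw [sum_measureReal_singleton, Finset.coe_univ, probReal_univ]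
    have hasum : ∑ k, (a k w).toReal = (α w).toReal := by
      rw [← hsuma w, ENNReal.toReal_sum fun k _ => hat k w]
    have hqsum : (∑ k, a k w ^ 2 / α w).toReal = ∑ k, (a k w).toReal ^ 2 / (α w).toReal := by
      rw [ENNReal.toReal_sum fun k _ => ((hq1 k w).trans_lt ENNReal.one_lt_top).ne]
      simp [ENNReal.toReal_div]
    have hpt : ∀ k, (a k w).toReal * (1 - Real.log b)
        - (a k w).toReal ^ 2 / (α w).toReal / b
        + ((a k w).toReal - (α w).toReal * (κ w.2).real {x | h w.1 x = k})
        ≤ Real.negMulLog ((κ w.2).real {x | h w.1 x = k}) := fun k => by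
      refine negMulLog_ge_of_le ENNReal.toReal_nonneg ?_
        (ENNReal.toReal_mono (hαt w) (haα k w)) measureReal_le_one hb0
      exact ENNReal.toReal_mono (measure_ne_top _ _) (Measure.restrict_apply_le _ _)
    have hs := Finset.sum_le_sum fun k (_ : k ∈ Finset.univ) => hpt k
    rw [Finset.sum_add_distrib, Finset.sum_sub_distrib, Finset.sum_sub_distrib, ← Finset.sum_mul,
      ← Finset.mul_sum, ← Finset.sum_div, hasum, hPsum, ← hqsum, mul_one, sub_self, add_zero] at hs
    rw [shannon_eq_div, mul_div_cancel₀ _ hlog.ne']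
    simp_rw [hP]
    exact hs
  rw [Real.logb, ← mul_div_assoc, neg_le, ← neg_le_neg_iff, neg_neg, ← neg_div, div_le_iff₀ hlog]
  linarith

end Leftover

/-! ### Chernoff bounds -/

section Chernoff

variable {Ω E : Type*} [MeasurableSpace Ω] [MeasurableSpace E] {μ : Measure Ω} {n : ℕ}

/-- Markov's inequality for the exponential of a sum of `n` i.i.d. variables. -/
theorem measure_sum_ge_le_exp {W : Fin n → Ω → E} {θ : Measure E} (hW : ∀ i, Measurable (W i))
    (hlaw : ∀ i, μ.map (W i) = θ) (hind : iIndepFun W μ) {ψ : E → ℝ} (hψ : Measurable ψ)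
    (s a : ℝ) (hs : 0 < s) :
    μ {ω | n * a ≤ ∑ i, ψ (W i ω)} ≤ EReal.exp ((n : EReal) *
      (ENNReal.log (∫⁻ x, ENNReal.ofReal (Real.exp (s * ψ x)) ∂θ) - ((s * a : ℝ) : EReal))) := by
  set M := ∫⁻ x, ENNReal.ofReal (Real.exp (s * ψ x)) ∂θ with hM
  have hφ : Measurable fun x => ENNReal.ofReal (Real.exp (s * ψ x)) :=
    (Real.measurable_exp.comp (hψ.const_mul s)).ennreal_ofReal
  have hE : ∫⁻ ω, ∏ i, ENNReal.ofReal (Real.exp (s * ψ (W i ω))) ∂μ = M ^ n := by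
    rw [lintegral_prod_eq_prod_lintegral_of_indepFun Finset.univ
      (fun i ω => ENNReal.ofReal (Real.exp (s * ψ (W i ω))))
      (hind.comp (fun _ x => ENNReal.ofReal (Real.exp (s * ψ x))) fun _ => hφ)
      (fun i => hφ.comp (hW i))]
    have : ∀ i, ∫⁻ ω, ENNReal.ofReal (Real.exp (s * ψ (W i ω))) ∂μ = M := fun i => by
      rw [hM, ← hlaw i, lintegral_map hφ (hW i)]
    simp [this]
  have hprod : ∀ ω, ∏ i, ENNReal.ofReal (Real.exp (s * ψ (W i ω)))
      = ENNReal.ofReal (Real.exp (s * ∑ i, ψ (W i ω))) := fun ω => by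
    rw [← ENNReal.ofReal_prod_of_nonneg fun i _ => (Real.exp_pos _).le, ← Real.exp_sum,
      Finset.mul_sum]
  simp_rw [hprod] at hE
  have hsum : Measurable fun ω => ∑ i, ψ (W i ω) :=
    Finset.measurable_sum _ fun i _ => hψ.comp (hW i)
  have hmk := mul_meas_ge_le_lintegral (μ := μ)
    (Real.measurable_exp.comp (hsum.const_mul s)).ennreal_ofReal
    (ENNReal.ofReal (Real.exp (s * (n * a))))
  simp only [Function.comp_def] at hmk
  rw [hE] at hmk
  have hset : {ω | n * a ≤ ∑ i, ψ (W i ω)} = {ω | ENNReal.ofReal (Real.exp (s * (n * a)))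
      ≤ ENNReal.ofReal (Real.exp (s * ∑ i, ψ (W i ω)))} := by
    ext ω
    simp only [Set.mem_ofPred_eq]
    rw [ENNReal.ofReal_le_ofReal_iff (Real.exp_pos _).le, Real.exp_le_exp, mul_le_mul_iff_right₀ hs]
  rw [← hset] at hmk
  rw [EReal.exp_nmul, sub_eq_add_neg, EReal.exp_add, ENNReal.exp_log, EReal.exp_neg,
    EReal.exp_coe, mul_pow, ← ENNReal.inv_pow, ← ENNReal.ofReal_pow (Real.exp_pos _).le,
    ← Real.exp_nat_mul, ← div_eq_mul_inv]
  rw [ENNReal.le_div_iff_mul_le (Or.inl (by simp [Real.exp_pos])) (Or.inl ENNReal.ofReal_ne_top),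
    mul_comm]
  rwa [show (n : ℝ) * (s * a) = s * (n * a) by ring]

/-- Multiplication by a positive finite n can be moved across an infimum in `EReal`, so optimizing
over s commutes with passing to the block exponent. -/
theorem le_exp_mul_iInf {m : ℝ≥0∞} (hn : n ≠ 0) {a : ℝ → EReal}
    (h : ∀ s, 0 < s → m ≤ EReal.exp ((n : EReal) * a s)) :
    m ≤ EReal.exp ((n : EReal) * ⨅ (s : ℝ) (_ : 0 < s), a s) := by
  have hn0 : (0 : EReal) < (n : EReal) := by exact_mod_cast Nat.pos_of_ne_zero hn
  have hnt : (n : EReal) ≠ ⊤ := EReal.natCast_ne_top n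
  rw [← ENNReal.exp_log m, EReal.exp_le_exp_iff, ← EReal.div_le_iff_le_mul hn0 hnt]
  refine le_iInf₂ fun s hs => ?_
  rw [EReal.div_le_iff_le_mul hn0 hnt, ← EReal.exp_le_exp_iff, ENNReal.exp_log]
  exact h s hs

variable {ν θ : Measure E}

/-- The logarithm, to base `2`, of the density `dθ/dν`. -/
def logDensity (ν θ : Measure E) (x : E) : ℝ := Real.logb 2 (θ.rnDeriv ν x).toReal

theorem measurable_logDensity (ν θ : Measure E) : Measurable (logDensity ν θ) :=
  (Real.measurable_log.comp (Measure.measurable_rnDeriv θ ν).ennreal_toReal).div_const _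

theorem entropy_eq (ν θ : Measure E) : entropy ν θ = -∫ x, logDensity ν θ x ∂θ := by
  rw [← integral_neg]; rfl

theorem ae_rnDeriv_pos_lt_top [SigmaFinite ν] [IsFiniteMeasure θ] (hac : θ ≪ ν) :
    ∀ᵐ x ∂θ, 0 < θ.rnDeriv ν x ∧ θ.rnDeriv ν x < ⊤ := by
  filter_upwards [Measure.rnDeriv_pos hac, hac.ae_le (Measure.rnDeriv_lt_top θ ν)] with x h1 h2
  exact ⟨h1, h2⟩

theorem lintegral_rnDeriv_rpow [SigmaFinite ν] [IsFiniteMeasure θ] (hac : θ ≪ ν) (s : ℝ) :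
    ∫⁻ x, (θ.rnDeriv ν x) ^ (s / Real.log 2) ∂θ
      = ∫⁻ x, ENNReal.ofReal (Real.exp (s * logDensity ν θ x)) ∂θ := by
  refine lintegral_congr_ae ?_
  filter_upwards [ae_rnDeriv_pos_lt_top hac] with x hx
  have h0 : 0 < (θ.rnDeriv ν x).toReal := ENNReal.toReal_pos hx.1.ne' hx.2.ne
  conv_lhs => rw [← ENNReal.ofReal_toReal hx.2.ne]
  rw [ENNReal.ofReal_rpow_of_pos h0, Real.rpow_def_of_pos h0, logDensity, Real.logb]
  congr 2
  ring

/-- The upper tail of `-log₂ p`. -/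
theorem measure_neg_logDensity_ge_le [SigmaFinite ν] [IsFiniteMeasure θ] (hac : θ ≪ ν)
    (hn : n ≠ 0) {W : Fin n → Ω → E} (hW : ∀ i, Measurable (W i))
    (hlaw : ∀ i, μ.map (W i) = θ) (hind : iIndepFun W μ) (ε : ℝ) :
    μ {ω | n * (entropy ν θ + ε) ≤ ∑ i, -logDensity ν θ (W i ω)}
      ≤ EReal.exp ((n : EReal) * chernoff₁ ν θ ε) := by
  refine le_exp_mul_iInf hn fun s hs => ?_
  have h := measure_sum_ge_le_exp hW hlaw hind (measurable_logDensity ν θ).neg s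
    (entropy ν θ + ε) hs
  rw [lintegral_rnDeriv_rpow hac]
  simpa [neg_mul] using h

/-- The upper tail of `log₂ p`. -/
theorem measure_logDensity_ge_le [SigmaFinite ν] [IsFiniteMeasure θ] (hac : θ ≪ ν)
    (hn : n ≠ 0) {W : Fin n → Ω → E} (hW : ∀ i, Measurable (W i))
    (hlaw : ∀ i, μ.map (W i) = θ) (hind : iIndepFun W μ) (ε : ℝ) :
    μ {ω | n * (-entropy ν θ + ε) ≤ ∑ i, logDensity ν θ (W i ω)}
      ≤ EReal.exp ((n : EReal) * chernoff₂ ν θ ε) := by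
  refine le_exp_mul_iInf hn fun s hs => ?_
  rw [lintegral_rnDeriv_rpow hac]
  exact measure_sum_ge_le_exp hW hlaw hind (measurable_logDensity ν θ) s (-entropy ν θ + ε) hs

/-- If every expectation were infinite, every term of the infimum would be `⊤`. -/
theorem exists_lintegral_exp_ne_top {m : ℝ → ℝ≥0∞} {c : ℝ → ℝ}
    (h : ⨅ (s : ℝ) (_ : 0 < s), (ENNReal.log (m s) - ((c s : ℝ) : EReal)) ≠ ⊤) :
    ∃ s, 0 < s ∧ m s ≠ ⊤ := by
  by_contra! hcon
  apply h
  simp only [iInf_eq_top]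
  intro s hs
  rw [hcon s hs, ENNReal.log_top]
  exact EReal.top_sub_coe _

/-- One finite exponential moment of each sign dominates |log₂ p|, since u ≤ exp u. This excludes
the default value 0 of the integral defining the entropy. -/
theorem integrable_logDensity [SigmaFinite ν] [IsFiniteMeasure θ] (hac : θ ≪ ν) {ε : ℝ}
    (h₁ : chernoff₁ ν θ ε ≠ ⊤) (h₂ : chernoff₂ ν θ ε ≠ ⊤) : Integrable (logDensity ν θ) θ := by
  obtain ⟨s, hs, hs'⟩ := exists_lintegral_exp_ne_top h₁
  obtain ⟨t, ht, ht'⟩ := exists_lintegral_exp_ne_top h₂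
  rw [lintegral_rnDeriv_rpow hac] at hs' ht'
  have hm := measurable_logDensity ν θ
  have hi : ∀ u : ℝ, ∫⁻ x, ENNReal.ofReal (Real.exp (u * logDensity ν θ x)) ∂θ ≠ ⊤ →
      Integrable (fun x => Real.exp (u * logDensity ν θ x)) θ := by
    intro u hu
    refine ⟨(Real.measurable_exp.comp (hm.const_mul u)).aestronglyMeasurable, ?_⟩
    rw [hasFiniteIntegral_iff_ofReal (ae_of_all _ fun x => (Real.exp_pos _).le)]
    exact hu.lt_top
  refine Integrable.mono' (((hi _ hs').div_const s).add ((hi _ ht').div_const t))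
    hm.aestronglyMeasurable (ae_of_all _ fun x => ?_)
  have e1 := Real.add_one_le_exp (-s * logDensity ν θ x)
  have e2 := Real.add_one_le_exp (t * logDensity ν θ x)
  have p1 := Real.exp_pos (-s * logDensity ν θ x)
  have p2 := Real.exp_pos (t * logDensity ν θ x)
  have q1 : -logDensity ν θ x ≤ Real.exp (-s * logDensity ν θ x) / s := by
    rw [le_div_iff₀ hs]; linarith
  have q2 : logDensity ν θ x ≤ Real.exp (t * logDensity ν θ x) / t := by
    rw [le_div_iff₀ ht]; linarith
  have r1 := div_pos p1 hs
  have r2 := div_pos p2 ht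
  simp only [Pi.add_apply]
  rw [Real.norm_eq_abs, abs_le]
  constructor <;> linarith

theorem chernoff_ne_top_of_chernoffSum_ne_top (hn : n ≠ 0) {ε : ℝ}
    (h : chernoffSum ν θ n ε ≠ ⊤) : chernoff₁ ν θ ε ≠ ⊤ ∧ chernoff₂ ν θ ε ≠ ⊤ := by
  have hn0 : (0 : EReal) < (n : EReal) := by exact_mod_cast Nat.pos_of_ne_zero hn
  obtain ⟨h1, h2⟩ := ENNReal.add_ne_top.1 h
  constructor
  · rintro h; simp [h, EReal.mul_top_of_pos hn0] at h1
  · rintro h; simp [h, EReal.mul_top_of_pos hn0] at h2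

end Chernoff

/-! ### Conditional densities of a discrete variable given a continuous one -/

section Density

variable {E 𝒳 : Type*} [MeasurableSpace E] [MeasurableSpace 𝒳]

/-- The conditional density `p(x | z) = p(z, x) / p(z)`. -/
def condDensity (ν : Measure E) (Q : Measure (E × 𝒳)) (w : E × 𝒳) : ℝ≥0∞ :=
  Q.rnDeriv (ν.prod Measure.count) w / Q.fst.rnDeriv ν w.1

theorem measurable_condDensity (ν : Measure E) (Q : Measure (E × 𝒳)) :
    Measurable (condDensity ν Q) :=
  (Measure.measurable_rnDeriv _ _).div ((Measure.measurable_rnDeriv _ _).comp measurable_fst)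

variable [Countable 𝒳] [DiscreteMeasurableSpace 𝒳]

theorem measure_le_of_forall_slice_le {α β : Measure (E × 𝒳)}
    (h : ∀ x, ∀ B, MeasurableSet B → α (B ×ˢ {x}) ≤ β (B ×ˢ {x})) : α ≤ β := by
  refine Measure.le_iff.2 fun S hS => ?_
  have hB : ∀ x, MeasurableSet ((fun e => (e, x)) ⁻¹' S) := fun x => measurable_prodMk_right hS
  have e : S = ⋃ x, ((fun e => (e, x)) ⁻¹' S) ×ˢ {x} := by
    ext ⟨a, b⟩; simp
  have hd : Pairwise (Function.onFun Disjoint fun x : 𝒳 => ((fun e => (e, x)) ⁻¹' S) ×ˢ {x}) :=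
    fun x y hxy => Set.disjoint_prod.2 (Or.inr (by simpa using hxy))
  rw [e, measure_iUnion hd fun x => (hB x).prod (measurableSet_singleton x),
    measure_iUnion hd fun x => (hB x).prod (measurableSet_singleton x)]
  exact ENNReal.tsum_le_tsum fun x => h x _ (hB x)

variable {ν : Measure E} [SigmaFinite ν] {Q : Measure (E × 𝒳)}

/-- Countability of the alphabet is what makes this work: a null set splits into countably many null
slices, each controlled by the first marginal. -/
theorem absolutelyContinuous_prod_count (hac : Q.fst ≪ ν) : Q ≪ ν.prod Measure.count := by
  refine Measure.AbsolutelyContinuous.mk fun S hS h0 => ?_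
  rw [Measure.prod_apply_symm hS, lintegral_count, ENNReal.tsum_eq_zero] at h0
  have e : S = ⋃ x, ((fun e => (e, x)) ⁻¹' S) ×ˢ {x} := by
    ext ⟨a, b⟩; simp
  rw [e, measure_iUnion_null_iff]
  intro x
  have h1 := hac (h0 x)
  rw [Measure.fst_apply (measurable_prodMk_right hS)] at h1
  exact measure_mono_null (by rintro ⟨a, b⟩ ⟨ha, -⟩; exact ha) h1

variable [IsProbabilityMeasure Q]

theorem eq_withDensity_condDensity (hac : Q.fst ≪ ν) :
    Q = (Q.fst.prod Measure.count).withDensity (condDensity ν Q) := by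
  have hQ := absolutelyContinuous_prod_count hac
  set pJ := Q.rnDeriv (ν.prod Measure.count) with hpJ
  set pZ := Q.fst.rnDeriv ν with hpZ
  have hpJm : Measurable pJ := Measure.measurable_rnDeriv _ _
  have hpZm : Measurable pZ := Measure.measurable_rnDeriv _ _
  have hpZm' : Measurable fun w : E × 𝒳 => pZ w.1 := hpZm.comp measurable_fst
  have h1 : Q.fst.prod Measure.count
      = (ν.prod (Measure.count : Measure 𝒳)).withDensity fun w => pZ w.1 := by
    conv_lhs => rw [← Measure.withDensity_rnDeriv_eq _ _ hac]
    rw [prod_withDensity_left hpZm]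
  have h2 : pJ =ᵐ[ν.prod Measure.count]
      (fun w : E × 𝒳 => pZ w.1) * condDensity ν Q := by
    have hfin : ∀ᵐ w ∂(ν.prod (Measure.count : Measure 𝒳)), pZ w.1 < ⊤ :=
      Measure.quasiMeasurePreserving_fst.ae (Measure.rnDeriv_lt_top Q.fst ν)
    have hS : MeasurableSet {w : E × 𝒳 | pZ w.1 = 0} := hpZm' (measurableSet_singleton 0)
    -- Where p(z) = 0 the product p(z) · (p(z, x) / p(z)) is 0 in `ℝ≥0∞`, so the factorization needs
    -- the joint density to vanish there too.
    have hzero : ∀ᵐ w ∂(ν.prod (Measure.count : Measure 𝒳)), pZ w.1 = 0 → pJ w = 0 := by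
      refine (ae_restrict_iff' hS).1 ?_
      have h3 : ∫⁻ w in {w : E × 𝒳 | pZ w.1 = 0}, pJ w ∂(ν.prod Measure.count) = 0 := by
        rw [← withDensity_apply _ hS, Measure.withDensity_rnDeriv_eq _ _ hQ]
        have hS0 : MeasurableSet {z | pZ z = 0} := hpZm (measurableSet_singleton 0)
        have h4 : Q.fst {z | pZ z = 0} = 0 := by
          rw [← Measure.withDensity_rnDeriv_eq _ _ hac,
            withDensity_apply _ hS0]
          rw [setLIntegral_congr_fun hS0 (g := fun _ => 0)
            (fun z hz => hz)]
          simp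
        rwa [Measure.fst_apply hS0] at h4
      exact (lintegral_eq_zero_iff hpJm).1 h3
    filter_upwards [hfin, hzero] with w hw1 hw2
    rw [Pi.mul_apply, condDensity, ← hpJ, ← hpZ]
    by_cases h0 : pZ w.1 = 0
    · rw [hw2 h0, h0, zero_mul]
    · rw [ENNReal.mul_div_cancel h0 hw1.ne]
  rw [h1, ← withDensity_mul _ hpZm' (measurable_condDensity ν Q), ← withDensity_congr_ae h2,
    Measure.withDensity_rnDeriv_eq _ _ hQ]

theorem ae_condDensity_eq (hac : Q.fst ≪ ν) : ∀ᵐ w ∂Q,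
    condDensity ν Q w = ENNReal.ofReal ((2 : ℝ) ^
        (logDensity (ν.prod Measure.count) Q w - logDensity ν Q.fst w.1)) ∧
    Real.logb 2 ((Q.rnDeriv (ν.prod Measure.count) w).toReal / (Q.fst.rnDeriv ν w.1).toReal)
      = logDensity (ν.prod Measure.count) Q w - logDensity ν Q.fst w.1 := by
  have hQ := absolutelyContinuous_prod_count hac
  have h1 : ∀ᵐ w ∂Q, 0 < Q.fst.rnDeriv ν w.1 ∧ Q.fst.rnDeriv ν w.1 < ⊤ :=
    ae_of_ae_map measurable_fst.aemeasurable (ae_rnDeriv_pos_lt_top hac)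
  filter_upwards [h1, ae_rnDeriv_pos_lt_top hQ] with w ⟨a0, a1⟩ ⟨b0, b1⟩
  have ha := ENNReal.toReal_pos a0.ne' a1.ne
  have hb := ENNReal.toReal_pos b0.ne' b1.ne
  have hl := Real.logb_div (b := 2) hb.ne' ha.ne'
  refine ⟨?_, hl⟩
  rw [logDensity, logDensity, ← hl, Real.rpow_logb (by norm_num) (by norm_num) (by positivity),
    ENNReal.ofReal_div_of_pos ha, ENNReal.ofReal_toReal a1.ne, ENNReal.ofReal_toReal b1.ne]
  rfl

theorem map_fst_restrict_eq_withDensity (hac : Q.fst ≪ ν) (x : 𝒳) :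
    (Q.restrict (Prod.snd ⁻¹' {x})).map Prod.fst
      = Q.fst.withDensity fun z => condDensity ν Q (z, x) := by
  refine Measure.ext fun B hB => ?_
  have hm := (measurable_condDensity ν Q).comp (measurable_prodMk_right (y := x))
  rw [Measure.map_apply measurable_fst hB, Measure.restrict_apply (measurable_fst hB),
    withDensity_apply _ hB]
  have e : Prod.fst ⁻¹' B ∩ Prod.snd ⁻¹' {x} = B ×ˢ ({x} : Set 𝒳) := rfl
  rw [e]
  conv_lhs => rw [eq_withDensity_condDensity hac]
  rw [withDensity_apply _ (hB.prod (measurableSet_singleton x)), ← Measure.prod_restrict,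
    lintegral_prod _ (measurable_condDensity ν Q).aemeasurable]
  refine lintegral_congr fun z => ?_
  rw [Measure.restrict_singleton, Measure.count_singleton, one_smul, lintegral_dirac]

/-- The product of the densities is the density of the product. -/
theorem pi_withDensity {n : ℕ} {θ : Measure E} [IsProbabilityMeasure θ] {r : Fin n → E → ℝ≥0∞}
    (hr : ∀ i, Measurable (r i)) [∀ i, IsFiniteMeasure (θ.withDensity (r i))] :
    Measure.pi (fun i => θ.withDensity (r i))
      = (Measure.pi fun _ : Fin n => θ).withDensity fun z => ∏ i, r i (z i) := by
  refine Measure.pi_eq fun s hs => ?_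
  rw [withDensity_apply _ (MeasurableSet.univ_pi hs),
    ← lintegral_indicator (MeasurableSet.univ_pi hs)]
  have e : ∀ z : Fin n → E, (Set.univ.pi s).indicator (fun z => ∏ i, r i (z i)) z
      = ∏ i, (s i).indicator (r i) (z i) := by
    intro z
    by_cases hz : z ∈ Set.univ.pi s
    · rw [Set.indicator_of_mem hz]
      exact Finset.prod_congr rfl fun i _ => (Set.indicator_of_mem (hz i trivial) _).symm
    · rw [Set.indicator_of_notMem hz]
      obtain ⟨i, hi⟩ : ∃ i, z i ∉ s i := by
        by_contra! hcon; exact hz fun i _ => hcon i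
      exact (Finset.prod_eq_zero (Finset.mem_univ i) (Set.indicator_of_notMem hi _)).symm
  simp_rw [e]
  have hm : ∀ i, Measurable ((s i).indicator (r i)) := fun i => (hr i).indicator (hs i)
  rw [lintegral_prod_eq_prod_lintegral_of_indepFun Finset.univ
    (fun i (z : Fin n → E) => (s i).indicator (r i) (z i))
    (iIndepFun_pi fun i => (hm i).aemeasurable) (fun i => (hm i).comp (measurable_pi_apply i))]
  refine Finset.prod_congr rfl fun i _ => ?_
  rw [withDensity_apply _ (hs i), ← lintegral_indicator (hs i)]
  have hmp := measurePreserving_eval (fun _ : Fin n => θ) i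
  exact hmp.lintegral_comp (hm i)

end Density

/-! ### Independent copies of the pair -/

section Block

variable {Ω E 𝒳 : Type*} [MeasurableSpace Ω] [MeasurableSpace E] [MeasurableSpace 𝒳] {n : ℕ}

/-- The conditional density `p(xⁿ | zⁿ)` of a memoryless source. -/
def blockDensity (ν : Measure E) (Q : Measure (E × 𝒳)) (z : Fin n → E) (x : Fin n → 𝒳) : ℝ≥0∞ :=
  ∏ i, condDensity ν Q (z i, x i)

theorem measurable_blockDensity (ν : Measure E) (Q : Measure (E × 𝒳)) :
    Measurable fun q : (Fin n → E) × (Fin n → 𝒳) => blockDensity ν Q q.1 q.2 :=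
  Finset.measurable_prod _ fun i _ => (measurable_condDensity ν Q).comp
    (((measurable_pi_apply i).comp measurable_fst).prodMk
      ((measurable_pi_apply i).comp measurable_snd))

variable [Countable 𝒳] [DiscreteMeasurableSpace 𝒳] {ν : Measure E} [SigmaFinite ν] {Q : Measure (E × 𝒳)}
  [IsProbabilityMeasure Q] {μ : Measure Ω}
  {Z : Fin n → Ω → E} {X : Fin n → Ω → 𝒳}

/-- For fixed xⁿ, both measures agree on boxes: independence of the pairs factors the left side, and
the one-letter conditional density identifies each factor. -/
theorem map_restrict_eq_withDensity_blockDensity (hac : Q.fst ≪ ν)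
    (hZ : ∀ i, Measurable (Z i)) (hX : ∀ i, Measurable (X i))
    (hlaw : ∀ i, μ.map (fun ω => (Z i ω, X i ω)) = Q)
    (hind : iIndepFun (fun i ω => (Z i ω, X i ω)) μ) (x : Fin n → 𝒳) :
    (μ.restrict {ω | (fun i => X i ω) = x}).map (fun ω i => Z i ω)
      = (Measure.pi fun _ : Fin n => Q.fst).withDensity fun z => blockDensity ν Q z x := by
  have hfin : ∀ i, IsFiniteMeasure (Q.fst.withDensity fun z => condDensity ν Q (z, x i)) := by
    intro i
    rw [← map_fst_restrict_eq_withDensity hac]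
    infer_instance
  have hm : ∀ i, Measurable fun z => condDensity ν Q (z, x i) := fun i =>
    (measurable_condDensity ν Q).comp measurable_prodMk_right
  have hZn : Measurable fun ω i => Z i ω := measurable_pi_lambda _ hZ
  have hXn : Measurable fun ω i => X i ω := measurable_pi_lambda _ hX
  have hxm : MeasurableSet {ω | (fun i => X i ω) = x} := hXn (measurableSet_singleton x)
  unfold blockDensity
  rw [← pi_withDensity hm]
  refine (Measure.pi_eq fun s hs => ?_).symm
  rw [Measure.map_apply hZn (MeasurableSet.univ_pi hs),
    Measure.restrict_apply (hZn (MeasurableSet.univ_pi hs))]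
  have e : (fun ω i => Z i ω) ⁻¹' Set.univ.pi s ∩ {ω | (fun i => X i ω) = x}
      = ⋂ i ∈ Finset.univ, (fun ω => (Z i ω, X i ω)) ⁻¹' (s i ×ˢ {x i}) := by
    ext ω
    simp [funext_iff, forall_and]
  rw [e, hind.measure_inter_preimage_eq_mul Finset.univ
    (fun i _ => (hs i).prod (measurableSet_singleton _))]
  refine Finset.prod_congr rfl fun i _ => ?_
  rw [← map_fst_restrict_eq_withDensity hac, Measure.map_apply measurable_fst (hs i),
    Measure.restrict_apply (measurable_fst (hs i)), ← hlaw i,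
    Measure.map_apply ((hZ i).prodMk (hX i))
      ((measurable_fst (hs i)).inter (measurable_snd (measurableSet_singleton _)))]
  rfl

end Block

/-! ### Entropy of the hash of a block -/

section HashBlock

variable {Ω E 𝒳 𝓕 : Type*} [MeasurableSpace Ω] [MeasurableSpace E] [MeasurableSpace 𝒳]
  [Countable 𝒳] [DiscreteMeasurableSpace 𝒳] [Fintype 𝓕] [MeasurableSpace 𝓕]
  [DiscreteMeasurableSpace 𝓕] {ν : Measure E} [SigmaFinite ν] {Q : Measure (E × 𝒳)}
  [IsProbabilityMeasure Q] {μ : Measure Ω} {n : ℕ}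
  {Z : Fin n → Ω → E} {X : Fin n → Ω → 𝒳} {F : Ω → 𝓕}

/-- A message with values in `𝓕` costs at most a factor `|𝓕|` in the density. -/
theorem restrict_blockDensity_le (hac : Q.fst ≪ ν)
    (hZ : ∀ i, Measurable (Z i)) (hX : ∀ i, Measurable (X i)) (hF : Measurable F)
    (hlaw : ∀ i, μ.map (fun ω => (Z i ω, X i ω)) = Q)
    (hind : iIndepFun (fun i ω => (Z i ω, X i ω)) μ) (c : ℝ≥0∞) :
    (μ.map fun ω => (((fun i => Z i ω), F ω), fun i => X i ω)).restrict
        {q | blockDensity ν Q q.1.1 q.2 ≤ c}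
      ≤ c • (((Measure.pi fun _ : Fin n => Q.fst).prod (Measure.count : Measure 𝓕)).prod
          (Measure.count : Measure (Fin n → 𝒳))) := by
  have hZn : Measurable fun ω i => Z i ω := measurable_pi_lambda _ hZ
  have hXn : Measurable fun ω i => X i ω := measurable_pi_lambda _ hX
  have hV : Measurable fun ω => (((fun i => Z i ω), F ω), fun i => X i ω) :=
    (hZn.prodMk hF).prodMk hXn
  refine measure_le_of_forall_slice_le fun x B hB => ?_
  have hR : Measurable fun z : Fin n → E => blockDensity ν Q z x :=
    (measurable_blockDensity ν Q).comp measurable_prodMk_right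
  have hBx := hB.prod (measurableSet_singleton x)
  have hBf : ∀ f : 𝓕, MeasurableSet ((fun z => (z, f)) ⁻¹' B) := fun f => measurable_prodMk_right hB
  have hTx : MeasurableSet {z : Fin n → E | blockDensity ν Q z x ≤ c} :=
    measurableSet_le hR measurable_const
  have hXx : MeasurableSet {ω | (fun i => X i ω) = x} := hXn (measurableSet_singleton x)
  rw [Measure.restrict_apply hBx, Measure.smul_apply, Measure.prod_prod, Measure.count_singleton,
    mul_one, Measure.prod_apply_symm hB, lintegral_count, tsum_fintype, smul_eq_mul,
    Finset.mul_sum]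
  have hT : MeasurableSet {q : ((Fin n → E) × 𝓕) × (Fin n → 𝒳) |
      blockDensity ν Q q.1.1 q.2 ≤ c} := measurableSet_le ((measurable_blockDensity ν Q).comp
        ((measurable_fst.comp measurable_fst).prodMk measurable_snd)) measurable_const
  rw [Measure.map_apply hV (hBx.inter hT)]
  -- Split by the value f of the message, then forget the event F = f. No relation between F and the
  -- source is needed; counting measure on 𝓕 absorbs the resulting sum over f.
  have hsub : (fun ω => (((fun i => Z i ω), F ω), fun i => X i ω)) ⁻¹'
      (B ×ˢ {x} ∩ {q | blockDensity ν Q q.1.1 q.2 ≤ c})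
      ⊆ ⋃ f ∈ (Finset.univ : Finset 𝓕), (fun ω i => Z i ω) ⁻¹'
        ((fun z => (z, f)) ⁻¹' B ∩ {z | blockDensity ν Q z x ≤ c})
          ∩ {ω | (fun i => X i ω) = x} := by
    rintro ω ⟨⟨h1, h2⟩, h3⟩
    have h2' : (fun i => X i ω) = x := h2
    have h3' : blockDensity ν Q (fun i => Z i ω) (fun i => X i ω) ≤ c := h3
    rw [h2'] at h3'
    simp only [Set.mem_iUnion]
    exact ⟨F ω, Finset.mem_univ _, ⟨h1, h3'⟩, h2'⟩
  refine (measure_mono hsub).trans ((measure_biUnion_finset_le _ _).trans ?_)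
  refine Finset.sum_le_sum fun f _ => ?_
  have hm := (hBf f).inter hTx
  rw [← Measure.restrict_apply (hZn hm), ← Measure.map_apply hZn hm,
    map_restrict_eq_withDensity_blockDensity hac hZ hX hlaw hind, withDensity_apply _ hm]
  calc ∫⁻ z in (fun z => (z, f)) ⁻¹' B ∩ {z | blockDensity ν Q z x ≤ c}, blockDensity ν Q z x
        ∂(Measure.pi fun _ : Fin n => Q.fst)
      ≤ ∫⁻ _ in (fun z => (z, f)) ⁻¹' B ∩ {z | blockDensity ν Q z x ≤ c}, c
        ∂(Measure.pi fun _ : Fin n => Q.fst) :=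
        setLIntegral_mono measurable_const fun z hz => hz.2
    _ ≤ c * (Measure.pi fun _ : Fin n => Q.fst) ((fun z => (z, f)) ⁻¹' B) := by
        rw [setLIntegral_const]
        gcongr
        exact Set.inter_subset_left

variable [IsProbabilityMeasure μ] {𝒮 : Type*} [MeasurableSpace 𝒮] {G : Ω → 𝒮}

/-- The entropy deficit of a `k`-bit hash is small if `p(xⁿ | zⁿ) ≤ 2^{-a}` with large
probability. -/
theorem sub_condShannon_le (hac : Q.fst ≪ ν)
    (hZ : ∀ i, Measurable (Z i)) (hX : ∀ i, Measurable (X i)) (hF : Measurable F)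
    (hlaw : ∀ i, μ.map (fun ω => (Z i ω, X i ω)) = Q)
    (hind : iIndepFun (fun i ω => (Z i ω, X i ω)) μ) (hG : Measurable G)
    (hindG : IndepFun G (fun ω => (((fun i => Z i ω), F ω), fun i => X i ω)) μ)
    {k : ℕ} {h : 𝒮 → (Fin n → 𝒳) → (Fin k → Bool)} (hh : IsUniversal₂ (μ.map G) h)
    {lrec : ℝ} (hlrec : Real.logb 2 (Fintype.card 𝓕) ≤ lrec) (a : ℝ) {p : ℝ}
    (hp : p = μ.real {ω | blockDensity ν Q (fun i => Z i ω) (fun i => X i ω)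
      ≤ ENNReal.ofReal ((2 : ℝ) ^ (-a))}) (hp0 : 0 < p) :
    k - condShannon μ (fun ω => h (G ω) (fun i => X i ω)) (fun ω => (G ω, (fun i => Z i ω), F ω))
      ≤ (1 - p) * k + p * Real.logb 2 (1 + (2 : ℝ) ^ (k + lrec - a) / p) := by
  have hne : Nonempty Ω := nonempty_of_isProbabilityMeasure μ
  have hneF : Nonempty 𝓕 := hne.map F
  have hneX : Nonempty (Fin n → 𝒳) := hne.map fun ω i => X i ω
  have hZn : Measurable fun ω i => Z i ω := measurable_pi_lambda _ hZ
  have hXn : Measurable fun ω i => X i ω := measurable_pi_lambda _ hX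
  have hT : MeasurableSet {q : ((Fin n → E) × 𝓕) × (Fin n → 𝒳) |
      blockDensity ν Q q.1.1 q.2 ≤ ENNReal.ofReal ((2 : ℝ) ^ (-a))} :=
    measurableSet_le ((measurable_blockDensity ν Q).comp
        ((measurable_fst.comp measurable_fst).prodMk measurable_snd)) measurable_const
  have hpT : (μ.map fun ω => (((fun i => Z i ω), F ω), fun i => X i ω)).real
      {q | blockDensity ν Q q.1.1 q.2 ≤ ENNReal.ofReal ((2 : ℝ) ^ (-a))} = p := by
    rw [hp, measureReal_def, measureReal_def, Measure.map_apply ((hZn.prodMk hF).prodMk hXn) hT]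
    rfl
  have hmain := le_condShannon_hash μ hXn (hZn.prodMk hF) hG hindG hh hT ENNReal.ofReal_ne_top
    (restrict_blockDensity_le hac hZ hX hF hlaw hind _) (by rw [hpT]; exact hp0)
  have hρ : ((Measure.pi fun _ : Fin n => Q.fst).prod (Measure.count : Measure 𝓕)).real Set.univ
      = Fintype.card 𝓕 := by
    rw [measureReal_def, ← Set.univ_prod_univ, Measure.prod_prod, measure_univ, one_mul]
    simp
  have hcard : (Fintype.card (Fin k → Bool) : ℝ) = (2 : ℝ) ^ k := by simp
  rw [hpT, hρ, hcard, ENNReal.toReal_ofReal (by positivity)] at hmain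
  have hFc : (0 : ℝ) < Fintype.card 𝓕 := by exact_mod_cast Fintype.card_pos
  have hFle : (Fintype.card 𝓕 : ℝ) ≤ (2 : ℝ) ^ lrec := by
    rwa [← Real.logb_le_iff_le_rpow (by norm_num) hFc]
  have hsplit : (2 : ℝ) ^ (k + lrec - a) = (2 : ℝ) ^ k * ((2 : ℝ) ^ (-a) * (2 : ℝ) ^ lrec) := by
    rw [← Real.rpow_natCast, ← Real.rpow_add (by norm_num), ← Real.rpow_add (by norm_num)]
    congr 1; ring
  have h2k : (0 : ℝ) < (2 : ℝ) ^ k := by positivity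
  have h2a : (0 : ℝ) < (2 : ℝ) ^ (-a) := by positivity
  -- Factoring out 2^{-k} yields the main term k; the entropy deficit then consists of the atypical
  -- part (1 - p) k and the logarithm that remains.
  have hlog : Real.logb 2 (((2 : ℝ) ^ k)⁻¹ + (2 : ℝ) ^ (-a) * Fintype.card 𝓕 / p)
      ≤ -k + Real.logb 2 (1 + (2 : ℝ) ^ (k + lrec - a) / p) := by
    have e1 : (-k : ℝ) = Real.logb 2 ((2 : ℝ) ^ k)⁻¹ := by
      rw [Real.logb_inv, Real.logb_pow, Real.logb_self_eq_one (by norm_num), mul_one]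
    rw [e1, ← Real.logb_mul (by positivity) (by positivity)]
    refine Real.logb_le_logb_of_le (by norm_num) (by positivity) ?_
    have e2 : ((2 : ℝ) ^ k)⁻¹ * (1 + (2 : ℝ) ^ (k + lrec - a) / p)
        = ((2 : ℝ) ^ k)⁻¹ + (2 : ℝ) ^ (-a) * (2 : ℝ) ^ lrec / p := by
      rw [hsplit]; field_simp
    rw [e2]
    gcongr
  have := mul_le_mul_of_nonneg_left hlog hp0.le
  linarith

end HashBlock

/-- A variable whose mean exceeds `a + 2` violates the tail bound `2^{a - t}` somewhere. -/
theorem exists_rpow_lt_measureReal {Ω : Type*} [MeasurableSpace Ω] {μ : Measure Ω}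
    [IsProbabilityMeasure μ] {L : Ω → ℝ} (hL : Measurable L) (hLi : Integrable L μ) {a : ℝ}
    (ha : 0 ≤ a) (hmean : a + 2 ≤ ∫ ω, L ω ∂μ) :
    ∃ t : ℝ, (2 : ℝ) ^ (a - t) < μ.real {ω | t ≤ L ω} := by
  by_contra! hcon
  have hlog : 0 < Real.log 2 := Real.log_pos (by norm_num)
  have hneg : -Real.log 2 < 0 := by linarith
  have hpow : ∀ t : ℝ, (2 : ℝ) ^ (a - t) = 2 ^ a * Real.exp (-Real.log 2 * t) := fun t => by
    rw [Real.rpow_sub (by norm_num), Real.rpow_def_of_pos (by norm_num) t, div_eq_mul_inv,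
      ← Real.exp_neg, neg_mul]
  have htail : ∫⁻ t in Set.Ioi a, μ {ω | t ≤ max (L ω) 0} ≤ ENNReal.ofReal (Real.log 2)⁻¹ := by
    have e : ENNReal.ofReal (Real.log 2)⁻¹
        = ∫⁻ t in Set.Ioi a, ENNReal.ofReal ((2 : ℝ) ^ (a - t)) := by
      rw [← ofReal_integral_eq_lintegral_ofReal]
      · simp_rw [hpow]
        rw [integral_const_mul, integral_exp_mul_Ioi hneg, Real.rpow_def_of_pos (by norm_num),
          neg_div_neg_eq, ← mul_div_assoc, ← Real.exp_add]
        simp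
      · simp_rw [hpow]
        exact (integrableOn_exp_mul_Ioi hneg a).const_mul _
      · exact ae_of_all _ fun t => by positivity
    rw [e]
    refine setLIntegral_mono' measurableSet_Ioi fun t ht => ?_
    have ht0 : 0 < t := ha.trans_lt ht
    have hset : {ω | t ≤ max (L ω) 0} = {ω | t ≤ L ω} := by
      ext ω
      simp only [Set.mem_ofPred_eq, le_max_iff, or_iff_left_iff_imp]
      intro h; linarith
    rw [hset, ← ofReal_measureReal]
    exact ENNReal.ofReal_le_ofReal (hcon t)
  have hbound : ∫⁻ ω, ENNReal.ofReal (max (L ω) 0) ∂μ ≤ ENNReal.ofReal (a + (Real.log 2)⁻¹) := by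
    -- Layer-cake formula split at a: below a the tail is at most 1, and above it the assumed bound
    -- integrates to 1 / ln 2, about 1.44. The 2 in the hypothesis exceeds this.
    rw [lintegral_eq_lintegral_meas_le (f := fun ω => max (L ω) 0) μ (ae_of_all _ fun ω => le_max_right _ _)
      (hL.max measurable_const).aemeasurable, ← Set.Ioc_union_Ioi_eq_Ioi ha,
      lintegral_union measurableSet_Ioi (Set.Ioc_disjoint_Ioi le_rfl),
      ENNReal.ofReal_add ha (by positivity)]
    refine add_le_add ?_ htail
    calc ∫⁻ t in Set.Ioc 0 a, μ {ω | t ≤ max (L ω) 0} ≤ ∫⁻ _ in Set.Ioc 0 a, 1 :=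
          lintegral_mono fun t => prob_le_one
      _ = ENNReal.ofReal a := by simp
  have hle : ∫ ω, L ω ∂μ ≤ a + (Real.log 2)⁻¹ := by
    calc ∫ ω, L ω ∂μ ≤ ∫ ω, max (L ω) 0 ∂μ :=
          integral_mono hLi hLi.pos_part fun ω => le_max_left _ _
      _ = (∫⁻ ω, ENNReal.ofReal (max (L ω) 0) ∂μ).toReal :=
          integral_eq_lintegral_of_nonneg_ae (ae_of_all _ fun ω => le_max_right _ _)
            (hL.max measurable_const).aestronglyMeasurable
      _ ≤ a + (Real.log 2)⁻¹ := ENNReal.toReal_le_of_le_ofReal (by positivity) hbound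
  have : (Real.log 2)⁻¹ < 2 := by
    rw [inv_lt_comm₀ hlog (by norm_num)]
    have := Real.log_two_gt_d9
    linarith
  linarith

/-! ### Conditional information of a block: typicality and strict positivity of the hash entropy -/

section Info

variable {Ω E 𝒳 𝓕 : Type*} [MeasurableSpace Ω] [MeasurableSpace E] [MeasurableSpace 𝒳]

/-- The conditional information density `-log₂ (p(z, x) / p(z))`. -/
def condInfo (ν : Measure E) (Q : Measure (E × 𝒳)) (w : E × 𝒳) : ℝ :=
  -Real.logb 2 ((Q.rnDeriv (ν.prod Measure.count) w).toReal / (Q.fst.rnDeriv ν w.1).toReal)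

theorem measurable_condInfo (ν : Measure E) (Q : Measure (E × 𝒳)) : Measurable (condInfo ν Q) := by
  refine Measurable.neg (Measurable.div_const (Real.measurable_log.comp ?_) _)
  exact (Measure.measurable_rnDeriv _ _).ennreal_toReal.div
    ((Measure.measurable_rnDeriv _ _).comp measurable_fst).ennreal_toReal

variable [Countable 𝒳] [DiscreteMeasurableSpace 𝒳] {ν : Measure E} [SigmaFinite ν]
  {Q : Measure (E × 𝒳)} [IsProbabilityMeasure Q] {μ : Measure Ω} {n : ℕ}
  {Z : Fin n → Ω → E} {X : Fin n → Ω → 𝒳} {F : Ω → 𝓕}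

theorem ae_condInfo_eq (hac : Q.fst ≪ ν) : ∀ᵐ w ∂Q, condInfo ν Q w
    = logDensity ν Q.fst w.1 - logDensity (ν.prod Measure.count) Q w := by
  filter_upwards [ae_condDensity_eq hac] with w hw
  rw [condInfo, hw.2]; ring

/-- The chain rule H(X|Z) = H(Z, X) - H(Z); integrability of both logarithms is what permits
splitting the integral. -/
theorem integral_condInfo_eq (hac : Q.fst ≪ ν)
    (h₁ : Integrable (logDensity ν Q.fst) Q.fst)
    (h₂ : Integrable (logDensity (ν.prod Measure.count) Q) Q) :
    ∫ w, condInfo ν Q w ∂Q = entropy (ν.prod Measure.count) Q - entropy ν Q.fst := by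
  have hm := (measurable_logDensity ν Q.fst).aestronglyMeasurable (μ := Q.fst)
  have h1 : Integrable (fun w : E × 𝒳 => logDensity ν Q.fst w.1) Q :=
    h₁.comp_aemeasurable measurable_fst.aemeasurable
  have h3 : ∫ z, logDensity ν Q.fst z ∂Q.fst = ∫ w, logDensity ν Q.fst w.1 ∂Q :=
    integral_map measurable_fst.aemeasurable hm
  rw [integral_congr_ae (ae_condInfo_eq hac), integral_sub h1 h₂, entropy_eq, entropy_eq, h3]
  ring

theorem ae_blockDensity_eq (hac : Q.fst ≪ ν) (hZ : ∀ i, Measurable (Z i))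
    (hX : ∀ i, Measurable (X i)) (hlaw : ∀ i, μ.map (fun ω => (Z i ω, X i ω)) = Q) :
    ∀ᵐ ω ∂μ, blockDensity ν Q (fun i => Z i ω) (fun i => X i ω)
        = ENNReal.ofReal ((2 : ℝ) ^ (-∑ i, condInfo ν Q (Z i ω, X i ω)))
      ∧ ∑ i, condInfo ν Q (Z i ω, X i ω) = ∑ i, logDensity ν Q.fst (Z i ω)
        - ∑ i, logDensity (ν.prod Measure.count) Q (Z i ω, X i ω) := by
  have h : ∀ i, ∀ᵐ ω ∂μ, condDensity ν Q (Z i ω, X i ω)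
      = ENNReal.ofReal ((2 : ℝ) ^ (-condInfo ν Q (Z i ω, X i ω))) ∧
      condInfo ν Q (Z i ω, X i ω) = logDensity ν Q.fst (Z i ω)
        - logDensity (ν.prod Measure.count) Q (Z i ω, X i ω) := by
    intro i
    have h' : ∀ᵐ w ∂(μ.map fun ω => (Z i ω, X i ω)), condDensity ν Q w
      = ENNReal.ofReal ((2 : ℝ) ^ (-condInfo ν Q w)) ∧
      condInfo ν Q w = logDensity ν Q.fst w.1 - logDensity (ν.prod Measure.count) Q w := by
      rw [hlaw i]
      filter_upwards [ae_condDensity_eq hac, ae_condInfo_eq hac] with w h1 h2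
      refine ⟨?_, h2⟩
      rw [h1.1, h2, neg_sub]
    exact ae_of_ae_map ((hZ i).prodMk (hX i)).aemeasurable h'
  filter_upwards [ae_all_iff.2 h] with ω hω
  constructor
  · rw [blockDensity, Finset.prod_congr rfl fun i _ => (hω i).1,
      ← ENNReal.ofReal_prod_of_nonneg fun i _ => by positivity, ← Finset.sum_neg_distrib,
      ← Real.rpow_sum_of_pos (by norm_num)]
  · rw [← Finset.sum_sub_distrib]
    exact Finset.sum_congr rfl fun i _ => (hω i).2

theorem ofReal_two_rpow_le_iff (a b : ℝ) :
    ENNReal.ofReal ((2 : ℝ) ^ (-a)) ≤ ENNReal.ofReal ((2 : ℝ) ^ (-b)) ↔ b ≤ a := by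
  rw [ENNReal.ofReal_le_ofReal_iff (by positivity), Real.rpow_le_rpow_left_iff (by norm_num),
    neg_le_neg_iff]

/-- Atypical blocks are exponentially unlikely. -/
theorem measure_blockDensity_gt_le (hac : Q.fst ≪ ν) (hn : n ≠ 0) (hZ : ∀ i, Measurable (Z i))
    (hX : ∀ i, Measurable (X i)) (hlaw : ∀ i, μ.map (fun ω => (Z i ω, X i ω)) = Q)
    (hind : iIndepFun (fun i ω => (Z i ω, X i ω)) μ) (ε ε' : ℝ) {a : ℝ}
    (ha : a = n * (entropy (ν.prod Measure.count) Q - entropy ν Q.fst - ε - ε')) :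
    μ {ω | blockDensity ν Q (fun i => Z i ω) (fun i => X i ω)
        ≤ ENNReal.ofReal ((2 : ℝ) ^ (-a))}ᶜ
      ≤ EReal.exp ((n : EReal) * chernoff₁ ν Q.fst ε)
        + EReal.exp ((n : EReal) * chernoff₂ (ν.prod Measure.count) Q ε') := by
  have hlawZ : ∀ i, μ.map (Z i) = Q.fst := fun i => by
    rw [← hlaw i, Measure.fst_map_prodMk (hX i)]
  have hindZ : iIndepFun Z μ := hind.comp (fun _ => Prod.fst) fun _ => measurable_fst
  have h1 := measure_neg_logDensity_ge_le hac hn hZ hlawZ hindZ ε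
  have h2 := measure_logDensity_ge_le (absolutelyContinuous_prod_count hac) hn
    (fun i => (hZ i).prodMk (hX i)) hlaw hind ε'
  refine le_trans ?_ ((measure_union_le _ _).trans (add_le_add h1 h2))
  refine measure_mono_ae ?_
  filter_upwards [ae_blockDensity_eq hac hZ hX hlaw] with ω hω hmem
  have hmem' : ¬ blockDensity ν Q (fun i => Z i ω) (fun i => X i ω)
        ≤ ENNReal.ofReal ((2 : ℝ) ^ (-a)) := hmem
  rw [hω.1, ofReal_two_rpow_le_iff, hω.2] at hmem'
  -- Outside both tail events, log p(zⁿ) - log p(zⁿ, xⁿ) exceeds a, so the block would be typical.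
  by_contra hcon
  have hcon' : ¬ (n * (entropy ν Q.fst + ε) ≤ ∑ i, -logDensity ν Q.fst (Z i ω) ∨
    n * (-entropy (ν.prod Measure.count) Q + ε')
      ≤ ∑ i, logDensity (ν.prod Measure.count) Q (Z i ω, X i ω)) := hcon
  rw [not_or, not_le, not_le, Finset.sum_neg_distrib] at hcon'
  apply hmem'
  rw [ha]
  linarith [hcon'.1, hcon'.2]

variable [IsProbabilityMeasure μ] [Fintype 𝓕] [MeasurableSpace 𝓕]
  [DiscreteMeasurableSpace 𝓕] {𝒮 : Type*} [MeasurableSpace 𝒮] {G : Ω → 𝒮}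

/-- The hash of a block is not a function of the seed and the side information if the conditional
entropy of the block exceeds the length of the message by three bits. -/
theorem sub_condShannon_lt (hac : Q.fst ≪ ν)
    (hZ : ∀ i, Measurable (Z i)) (hX : ∀ i, Measurable (X i)) (hF : Measurable F)
    (hlaw : ∀ i, μ.map (fun ω => (Z i ω, X i ω)) = Q)
    (hind : iIndepFun (fun i ω => (Z i ω, X i ω)) μ) (hG : Measurable G)
    (hindG : IndepFun G (fun ω => (((fun i => Z i ω), F ω), fun i => X i ω)) μ)
    {k : ℕ} (hk : 1 ≤ k) {h : 𝒮 → (Fin n → 𝒳) → (Fin k → Bool)} (hh : IsUniversal₂ (μ.map G) h)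
    {lrec : ℝ} (hlrec : Real.logb 2 (Fintype.card 𝓕) ≤ lrec) (hlrec0 : 0 ≤ lrec)
    (hent : lrec + 3 ≤ n * ∫ w, condInfo ν Q w ∂Q) :
    k - condShannon μ (fun ω => h (G ω) (fun i => X i ω)) (fun ω => (G ω, (fun i => Z i ω), F ω))
      < k := by
  have hm := measurable_condInfo ν Q
  -- A non-integrable function has integral 0 by convention, incompatible with 3 ≤ lrec + 3 ≤ n · 0.
  have hint : Integrable (condInfo ν Q) Q := by
    by_contra hni
    rw [integral_undef hni] at hent
    linarith
  have hW : ∀ i, Measurable fun ω => (Z i ω, X i ω) := fun i => (hZ i).prodMk (hX i)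
  have hinti : ∀ i, Integrable (fun ω => condInfo ν Q (Z i ω, X i ω)) μ := fun i =>
    (MeasurePreserving.mk (hW i) (hlaw i)).integrable_comp_of_integrable hint
  have hmean : ∫ ω, ∑ i, condInfo ν Q (Z i ω, X i ω) ∂μ = n * ∫ w, condInfo ν Q w ∂Q := by
    rw [integral_finsetSum _ fun i _ => hinti i]
    have : ∀ i, ∫ ω, condInfo ν Q (Z i ω, X i ω) ∂μ = ∫ w, condInfo ν Q w ∂Q := fun i => by
      have e := integral_map (μ := μ) (hW i).aemeasurable (f := condInfo ν Q)
        hm.aestronglyMeasurable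
      rw [hlaw i] at e
      exact e.symm
    simp [this]
  -- The 3 bits split as 2 + 1: two pay for the tail argument, and the third makes the ratio 2^{k +
  -- lrec - a} / p smaller than 2^{k - 1}, so that 1 plus the ratio stays below 2^k.
  obtain ⟨a, ha⟩ := exists_rpow_lt_measureReal (μ := μ) (a := 1 + lrec)
    (Finset.measurable_sum Finset.univ fun i _ => hm.comp (hW i))
    (integrable_finsetSum _ fun i _ => hinti i) (by linarith)
    (by
      simp only [Function.comp_def]
      rw [hmean]; linarith)
  set p := μ.real {ω | blockDensity ν Q (fun i => Z i ω) (fun i => X i ω)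
      ≤ ENNReal.ofReal ((2 : ℝ) ^ (-a))} with hp
  have hpa : (2 : ℝ) ^ (1 + lrec - a) < p := by
    refine ha.trans_eq (measureReal_congr ?_)
    filter_upwards [ae_blockDensity_eq hac hZ hX hlaw] with ω hω
    refine propext ?_
    change a ≤ ∑ i, condInfo ν Q (Z i ω, X i ω) ↔ blockDensity ν Q (fun i => Z i ω)
      (fun i => X i ω) ≤ ENNReal.ofReal ((2 : ℝ) ^ (-a))
    rw [hω.1, ofReal_two_rpow_le_iff]
  have hp0 : 0 < p := lt_trans (by positivity) hpa
  have hmain := sub_condShannon_le hac hZ hX hF hlaw hind hG hindG hh hlrec a hp hp0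
  have hlt : (2 : ℝ) ^ (k + lrec - a) / p < (2 : ℝ) ^ (k - 1 : ℝ) := by
    rw [div_lt_iff₀ hp0, show (k + lrec - a : ℝ) = (k - 1) + (1 + lrec - a) by ring,
      Real.rpow_add (by norm_num)]
    gcongr
  have h1 : (1 : ℝ) ≤ (2 : ℝ) ^ (k - 1 : ℝ) := by
    refine Real.one_le_rpow (by norm_num) ?_
    have : (1 : ℝ) ≤ k := by exact_mod_cast hk
    linarith
  have h2 : (2 : ℝ) ^ (k : ℝ) = 2 ^ (k - 1 : ℝ) + 2 ^ (k - 1 : ℝ) := by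
    rw [← two_mul, ← Real.rpow_one_add' (by norm_num) (by
      have : (1 : ℝ) ≤ k := by exact_mod_cast hk
      linarith)]
    congr 1; ring
  have hlog : Real.logb 2 (1 + (2 : ℝ) ^ (k + lrec - a) / p) < k := by
    rw [Real.logb_lt_iff_lt_rpow (by norm_num) (by positivity), h2]
    linarith
  have := mul_lt_mul_of_pos_left hlog hp0
  linarith

end Info

/-- Universal₂ random functions on a countable set exist: independent uniform values. -/
theorem exists_isUniversal₂ (A 𝒦 : Type*) [Countable A] [Fintype 𝒦] [Nonempty 𝒦]
    [MeasurableSpace 𝒦] [MeasurableSingletonClass 𝒦] :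
    ∃ (σ : Measure (ℕ → 𝒦)) (h : (ℕ → 𝒦) → A → 𝒦), IsProbabilityMeasure σ ∧ IsUniversal₂ σ h := by
  -- Indexing the coordinates by ℕ instead of `A` keeps the seed space in the universe of the key
  -- set.
  obtain ⟨e, he⟩ := exists_injective_nat A
  let U : Measure 𝒦 := uniformOn Set.univ
  have hU : IsProbabilityMeasure U := isProbabilityMeasure_uniformOn Set.finite_univ Set.univ_nonempty
  have hU1 : ∀ k, U {k} = (Fintype.card 𝒦 : ℝ≥0∞)⁻¹ := fun k => by
    simp [U, uniformOn_univ]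
  refine ⟨Measure.infinitePi fun _ => U, fun s x => s (e x), inferInstance,
    fun x => measurable_pi_apply _, fun x x' hxx => ?_⟩
  have hind : iIndepFun (fun (i : ℕ) (s : ℕ → 𝒦) => s i) (Measure.infinitePi fun _ => U) :=
    iIndepFun_infinitePi (X := fun _ => id) fun _ => measurable_id
  have hpair := (indepFun_iff_map_prod_eq_prod_map_map (measurable_pi_apply (e x)).aemeasurable
    (measurable_pi_apply (e x')).aemeasurable).1 (hind.indepFun (he.ne hxx))
  have hm : ∀ i, (Measure.infinitePi fun _ : ℕ => U).map (fun s => s i) = U := fun i =>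
    (measurePreserving_eval_infinitePi (fun _ : ℕ => U) i).map_eq
  have hd : MeasurableSet {q : 𝒦 × 𝒦 | q.1 = q.2} := MeasurableSet.of_discrete
  have e1 : (Measure.infinitePi fun _ : ℕ => U) {s | s (e x) = s (e x')}
      = (U.prod U) {q : 𝒦 × 𝒦 | q.1 = q.2} := by
    rw [hm, hm] at hpair
    rw [← hpair, Measure.map_apply ((measurable_pi_apply _).prodMk (measurable_pi_apply _)) hd]
    rfl
  rw [e1, Measure.prod_apply hd]
  have e2 : ∀ k : 𝒦, Prod.mk k ⁻¹' {q : 𝒦 × 𝒦 | q.1 = q.2} = {k} := fun k => by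
    ext j; simp [eq_comm]
  simp [e2, hU1]

/-! ### Numerical consequences of admissibility -/

section KeyLength

variable {d : ℕ} {𝒳 : Type*} [MeasurableSpace 𝒳] {Q : Measure ((Fin d → ℝ) × 𝒳)} {n : ℕ}
  {lrec εL εU : ℝ} {t : Params}

theorem δ₂_pos : 0 < δ₂ n t := by unfold δ₂; positivity

theorem δ₂_le_one (ht : t ∈ admissible Q n lrec εL εU) : δ₂ n t ≤ 1 := by
  obtain ⟨hε, -, hb, -⟩ := ht
  refine Real.rpow_le_one_of_one_le_of_nonpos (by norm_num) ?_
  have := hε.1.le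
  have := hb.1.le
  have : (0 : ℝ) ≤ n * t.b₀ * t.ε := by positivity
  linarith

/-- Only the sign of this correction is used. The argument needs only δ₂ ≤ 1, since `Real.logb 2 0 =
0`. -/
theorem logb_one_sub_δ₂_nonpos (ht : t ∈ admissible Q n lrec εL εU) :
    Real.logb 2 (1 - δ₂ n t) ≤ 0 :=
  Real.logb_nonpos (by norm_num) (by linarith [δ₂_le_one ht]) (by linarith [δ₂_pos (n := n) (t := t)])

theorem bddAbove_keyLengths : BddAbove (keyLengths Q n lrec εL εU) := by
  refine ⟨⌊n * condEntropyXZ Q - lrec⌋, ?_⟩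
  rintro _ ⟨t, ht, rfl⟩
  refine Int.floor_le_floor ?_
  have h1 := logb_one_sub_δ₂_nonpos ht
  obtain ⟨hε, hε', -, -, hf, hg, -⟩ := ht
  have h2 : (n : ℝ) * (condEntropyXZ Q - t.ε - t.ε') ≤ n * condEntropyXZ Q :=
    mul_le_mul_of_nonneg_left (by linarith [hε.1, hε'.1]) n.cast_nonneg
  linarith [hf n, hg n]

theorem ne_zero_of_admissible (ht : t ∈ admissible Q n lrec εL εU) : n ≠ 0 := by
  obtain ⟨-, -, -, -, -, -, ⟨n₀, hn, -⟩, -⟩ := ht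
  omega

theorem chernoffSum_le_of_admissible (ht : t ∈ admissible Q n lrec εL εU) :
    chernoffSum volume Q.fst n t.ε' + chernoffSum (refZX d 𝒳) Q n t.ε'
      ≤ ENNReal.ofReal ((2 : ℝ) ^ (-(n * t.b₁ * t.ε))) := by
  obtain ⟨-, -, -, -, -, -, ⟨n₀, hn, h⟩, -⟩ := ht
  rw [mul_comm (n : ℝ) t.b₁]
  exact h n hn

/-- The entropy deficit is below the threshold if it is below the key length and obeys the leftover
hash bound. -/
theorem lt_min_of_admissible (ht : t ∈ admissible Q n lrec εL εU) {k : ℕ} (hk : 1 ≤ k)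
    (hkt : kbar Q n lrec t = k) {D p : ℝ} (hDk : D < k)
    (hp : ENNReal.ofReal (1 - p) ≤ EReal.exp ((n : EReal) * chernoff₁ volume Q.fst t.ε)
        + EReal.exp ((n : EReal) * chernoff₂ (refZX d 𝒳) Q t.ε'))
    (hp1 : p ≤ 1)
    (hD : 0 < p → D ≤ (1 - p) * k + p * Real.logb 2
      (1 + (2 : ℝ) ^ (k + lrec - n * (condEntropyXZ Q - t.ε - t.ε')) / p)) :
    D < min εL εU := by
  have hlog2 := logb_one_sub_δ₂_nonpos ht
  have hcs := chernoffSum_le_of_admissible ht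
  have hkfloor : (k : ℝ) ≤ n * (condEntropyXZ Q - t.ε - t.ε') + Real.logb 2 (1 - δ₂ n t) - lrec
      - 2 * t.f n - t.g n - 2 := by
    have := Int.floor_le (n * (condEntropyXZ Q - t.ε - t.ε') + Real.logb 2 (1 - δ₂ n t) - lrec
      - 2 * t.f n - t.g n - 2)
    change ((kbar Q n lrec t : ℤ) : ℝ) ≤ _ at this
    rw [hkt] at this
    exact_mod_cast this
  obtain ⟨-, -, -, -, hf, hg, -, -, -, -, hδ⟩ := ht
  have hk1 : (1 : ℝ) ≤ k := by exact_mod_cast hk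
  have hg1 : (2 : ℝ) ^ (-t.g n) ≤ 1 :=
    Real.rpow_le_one_of_one_le_of_nonpos (by norm_num) (by linarith [hg n])
  have hg0 : (0 : ℝ) < (2 : ℝ) ^ (-t.g n) := by positivity
  have hδ4 : δ₄ n t ≤ 1 := by
    unfold δ₄
    rw [Real.logb_le_iff_le_rpow (by norm_num) (by positivity), Real.rpow_one]
    linarith
  unfold δ₅ at hδ
  rw [hkt] at hδ
  push_cast at hδ
  rcases lt_or_ge (δ₃ Q n t) 1 with h3 | h3
  · have h3t : δ₃ Q n t ≠ ⊤ := (h3.trans ENNReal.one_lt_top).ne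
    set d3 := (δ₃ Q n t).toReal with hd3
    have hd3' : ((δ₃ Q n t : ℝ≥0∞) : EReal) = ((d3 : ℝ) : EReal) :=
      (EReal.coe_ennreal_toReal h3t).symm
    have hd31 : d3 < 1 := by
      have := (ENNReal.toReal_lt_toReal h3t ENNReal.one_ne_top).2 h3
      simpa using this
    have hmin : d3 * (k - δ₄ n t) + δ₄ n t ≤ min εL εU := by
      rw [hd3'] at hδ
      exact_mod_cast hδ
    -- The Z-tail is one summand of δ⁽¹⁾, and the (Z, X)-tail is at most 2^{-n b₁ ε} by the
    -- constraint at m = n. The term 2^{-n (b₁ - b₀) ε} is slack.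
    have hpd : (1 - p) + (2 : ℝ) ^ (-t.f n) ≤ d3 := by
      rw [hd3, ← ENNReal.ofReal_le_iff_le_toReal h3t,
        ENNReal.ofReal_add (by linarith) (by positivity), add_comm]
      unfold δ₃ δ₁
      gcongr
      refine (hp.trans (add_le_add le_self_add ?_)).trans le_self_add
      exact (le_add_self.trans le_add_self).trans hcs
    have hf0 : (0 : ℝ) < (2 : ℝ) ^ (-t.f n) := by positivity
    have hpf : (2 : ℝ) ^ (-t.f n) < p := by linarith
    have hp0 : 0 < p := hf0.trans hpf
    have hlt : Real.logb 2 (1 + (2 : ℝ) ^ (k + lrec - n * (condEntropyXZ Q - t.ε - t.ε')) / p)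
        < δ₄ n t := by
      unfold δ₄
      refine Real.logb_lt_logb (by norm_num) (by positivity) ?_
      gcongr
      rw [div_lt_iff₀ hp0]
      calc (2 : ℝ) ^ (k + lrec - n * (condEntropyXZ Q - t.ε - t.ε'))
          ≤ (2 : ℝ) ^ (-t.g n + -t.f n) :=
            Real.rpow_le_rpow_of_exponent_le (by norm_num) (by linarith [hf n])
        _ = (2 : ℝ) ^ (-t.g n) * (2 : ℝ) ^ (-t.f n) := Real.rpow_add (by norm_num) _ _
        _ < (2 : ℝ) ^ (-t.g n) * p := by gcongr
    refine lt_of_lt_of_le ?_ hmin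
    have h4 := mul_lt_mul_of_pos_left hlt hp0
    -- Since δ⁽⁴⁾ ≤ 1 ≤ k, the expression (1 - p) k + p δ⁽⁴⁾ = (1 - p)(k - δ⁽⁴⁾) + δ⁽⁴⁾ grows when 1
    -- - p is replaced by δ⁽³⁾.
    have h5 : 0 ≤ (d3 - (1 - p)) * (k - δ₄ n t) :=
      mul_nonneg (by linarith) (by linarith)
    linarith [hD hp0]
  -- Here δ⁽³⁾ ≥ 1, possibly infinite, so δ⁽⁵⁾ ≥ (k - δ⁽⁴⁾) + δ⁽⁴⁾ = k, and the threshold is at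
  -- least k.
  · refine hDk.trans_le ?_
    have hnn : (0 : EReal) ≤ ((k - δ₄ n t : ℝ) : EReal) := by
      exact_mod_cast (by linarith : (0 : ℝ) ≤ k - δ₄ n t)
    have h31 : (1 : EReal) ≤ (δ₃ Q n t : EReal) := by exact_mod_cast h3
    have h := add_le_add (mul_le_mul_of_nonneg_right h31 hnn) (le_refl (δ₄ n t : EReal))
    rw [one_mul] at h
    push_cast at h
    have h' := h.trans hδ
    have h6 : ((k - δ₄ n t + δ₄ n t : ℝ) : EReal) ≤ ((min εL εU : ℝ) : EReal) := by
      push_cast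
      exact h'
    have h7 := EReal.coe_le_coe_iff.1 h6
    linarith

end KeyLength

end FiniteKey

end

theorem mainTheorem1
    {Ω 𝒳 𝒴 𝓕 : Type*} [MeasurableSpace Ω]
    [MeasurableSpace 𝒳] [Countable 𝒳] [DiscreteMeasurableSpace 𝒳] [MeasurableSpace 𝒴]
    [Fintype 𝓕] [MeasurableSpace 𝓕] [DiscreteMeasurableSpace 𝓕] {d : ℕ}
    -- the single-letter law of `(X, Y, Z)`; `Z` is continuous, `X` is discrete
    (P : Measure (𝒳 × 𝒴 × (Fin d → ℝ))) [IsProbabilityMeasure P]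
    (hPZ : P.map (fun w => w.2.2) ≪ volume)
    -- `n` independent uses of the source
    (μ : Measure Ω) [IsProbabilityMeasure μ] (n : ℕ)
    (X : Fin n → Ω → 𝒳) (Y : Fin n → Ω → 𝒴) (Z : Fin n → Ω → (Fin d → ℝ))
    (hX : ∀ i, Measurable (X i)) (hY : ∀ i, Measurable (Y i)) (hZ : ∀ i, Measurable (Z i))
    (hlaw : ∀ i, μ.map (fun ω => (X i ω, Y i ω, Z i ω)) = P)
    (hindep : iIndepFun (fun i ω => (X i ω, Y i ω, Z i ω)) μ)
    -- reconciliation: public message `F`, at most `lrec` bits; Bob decodes from `(Y^n, F)`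
    (F : Ω → 𝓕) (hF : Measurable F) (lrec : ℝ)
    (hlrec : Real.logb 2 (Fintype.card 𝓕) ≤ lrec)
    (dec : (Fin n → 𝒴) → 𝓕 → (Fin n → 𝒳))
    (hdec : Measurable fun q : (Fin n → 𝒴) × 𝓕 => dec q.1 q.2)
    (εL εU : ℝ) (hεL : 0 < εL) (hεU : 0 < εU)
    (hne : (FiniteKey.admissible (P.map fun w => (w.2.2, w.1)) n lrec εL εU).Nonempty) :
    BddAbove (FiniteKey.keyLengths (P.map fun w => (w.2.2, w.1)) n lrec εL εU) ∧
    ∀ k : ℕ, k = (FiniteKey.keyLength (P.map fun w => (w.2.2, w.1)) n lrec εL εU).toNat →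
      -- a universal₂ random hash function with `k`-bit values exists
      (∃ (𝒮 : Type) (_ : MeasurableSpace 𝒮) (σ : Measure 𝒮)
        (h : 𝒮 → (Fin n → 𝒳) → (Fin k → Bool)),
        IsProbabilityMeasure σ ∧ FiniteKey.IsUniversal₂ σ h) ∧
      -- privacy amplification with any such hash function, chosen independently of the rest
      ∀ {𝒮 : Type*} [MeasurableSpace 𝒮] (G : Ω → 𝒮) (h : 𝒮 → (Fin n → 𝒳) → (Fin k → Bool)),
        Measurable G →
        IndepFun G (fun ω => ((fun i => X i ω), (fun i => Y i ω), (fun i => Z i ω), F ω)) μ →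
        FiniteKey.IsUniversal₂ (μ.map G) h →
        let Xn : Ω → (Fin n → 𝒳) := fun ω i => X i ω
        let Xhat : Ω → (Fin n → 𝒳) := fun ω => dec (fun i => Y i ω) (F ω)
        let Zn : Ω → (Fin n → Fin d → ℝ) := fun ω i => Z i ω
        let K : Ω → (Fin k → Bool) := fun ω => h (G ω) (Xn ω)
        let Khat : Ω → (Fin k → Bool) := fun ω => h (G ω) (Xhat ω)
        FiniteKey.mutualInfo μ K (fun ω => (Zn ω, F ω)) < εL ∧
        FiniteKey.mutualInfo μ K (fun ω => (G ω, Zn ω, F ω)) < εL ∧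
        FiniteKey.uniformity μ K < εU ∧
        μ {ω | K ω ≠ Khat ω} ≤ μ {ω | Xhat ω ≠ Xn ω} := by
  set Q := P.map fun w => (w.2.2, w.1) with hQ
  have hproj : Measurable fun w : 𝒳 × 𝒴 × (Fin d → ℝ) => (w.2.2, w.1) :=
    (measurable_snd.comp measurable_snd).prodMk measurable_fst
  have hQp : IsProbabilityMeasure Q := Measure.isProbabilityMeasure_map hproj.aemeasurable
  have hac : Q.fst ≪ volume := by
    rw [hQ, Measure.fst_map_prodMk measurable_fst]
    exact hPZ
  have hlawQ : ∀ i, μ.map (fun ω => (Z i ω, X i ω)) = Q := fun i => by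
    rw [hQ, ← hlaw i, Measure.map_map hproj ((hX i).prodMk ((hY i).prodMk (hZ i)))]
    rfl
  have hindQ : iIndepFun (fun i ω => (Z i ω, X i ω)) μ := hindep.comp (fun _ => _) fun _ => hproj
  have hbdd := FiniteKey.bddAbove_keyLengths (Q := Q) (n := n) (lrec := lrec) (εL := εL) (εU := εU)
  refine ⟨hbdd, fun k hk => ⟨?_, ?_⟩⟩
  · obtain ⟨σ, h, hσ, hh⟩ := FiniteKey.exists_isUniversal₂ (Fin n → 𝒳) (Fin k → Bool)
    exact ⟨_, _, σ, h, hσ, hh⟩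
  intro 𝒮 _ G h hG hind hh Xn Xhat Zn K Khat
  have hXn : Measurable Xn := measurable_pi_lambda _ hX
  have hZn : Measurable Zn := measurable_pi_lambda _ hZ
  have hK : Measurable K := hh.measurable_uncurry.comp (hG.prodMk hXn)
  have hV : Measurable fun ω => (Zn ω, F ω) := hZn.prodMk hF
  have hindG : IndepFun G (fun ω => ((Zn ω, F ω), Xn ω)) μ :=
    hind.comp (φ := id)
      (ψ := fun q : (Fin n → 𝒳) × (Fin n → 𝒴) × (Fin n → Fin d → ℝ) × 𝓕 =>
        ((q.2.2.1, q.2.2.2), q.1)) measurable_id (by fun_prop)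
  have hKp := Measure.isProbabilityMeasure_map (μ := μ) hK.aemeasurable
  have hcard : Real.logb 2 (Fintype.card (Fin k → Bool)) = k := by
    simp [Real.logb_pow, Real.logb_self_eq_one]
  have hshk : FiniteKey.shannon (μ.map K) ≤ k := hcard ▸ FiniteKey.shannon_le_logb_card (μ.map K)
  have hGV : FiniteKey.condShannon μ K (fun ω => (G ω, Zn ω, F ω))
      ≤ FiniteKey.condShannon μ K (fun ω => (Zn ω, F ω)) :=
    FiniteKey.condShannon_prodMk_le μ hK hV hG (hindG.comp measurable_id measurable_fst)
  have hsh : FiniteKey.condShannon μ K (fun ω => (G ω, Zn ω, F ω))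
      ≤ FiniteKey.shannon (μ.map K) := FiniteKey.condShannon_le_shannon μ hK (hG.prodMk hV)
  have hnn : 0 ≤ FiniteKey.condShannon μ K (fun ω => (G ω, Zn ω, F ω)) :=
    FiniteKey.condShannon_nonneg μ
  have hmain : k - FiniteKey.condShannon μ K (fun ω => (G ω, Zn ω, F ω)) < min εL εU := by
    rcases Nat.eq_zero_or_pos k with hk0 | hkpos
    · have hk0' : (k : ℝ) = 0 := by exact_mod_cast hk0
      have := lt_min hεL hεU
      linarith
    -- A nonempty set of integers bounded above contains its supremum, so one parameter tuple
    -- realizes k. For k > 0 the truncation by `toNat` changes nothing.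
    have hmem := Int.csSup_mem (hne.image (FiniteKey.kbar Q n lrec)) hbdd
    obtain ⟨t, ht, hkt⟩ := hmem
    have hkt' : FiniteKey.kbar Q n lrec t = k := by
      have : FiniteKey.kbar Q n lrec t = FiniteKey.keyLength Q n lrec εL εU := hkt
      omega
    have hn := FiniteKey.ne_zero_of_admissible ht
    have hneF : Nonempty 𝓕 := (nonempty_of_isProbabilityMeasure μ).map F
    have hlrec0 : 0 ≤ lrec := by
      refine le_trans (Real.logb_nonneg (by norm_num) ?_) hlrec
      exact_mod_cast Nat.one_le_iff_ne_zero.2 Fintype.card_ne_zero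
    have hcs := FiniteKey.chernoffSum_le_of_admissible ht
    have hcs' := ENNReal.add_ne_top.1 (hcs.trans_lt ENNReal.ofReal_lt_top).ne
    obtain ⟨hc1, hc2⟩ := FiniteKey.chernoff_ne_top_of_chernoffSum_ne_top hn hcs'.1
    obtain ⟨hc3, hc4⟩ := FiniteKey.chernoff_ne_top_of_chernoffSum_ne_top hn hcs'.2
    have hent : FiniteKey.condEntropyXZ Q
        = FiniteKey.entropy (volume.prod Measure.count) Q - FiniteKey.entropy volume Q.fst :=
      FiniteKey.integral_condInfo_eq hac (FiniteKey.integrable_logDensity hac hc1 hc2)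
        (FiniteKey.integrable_logDensity (FiniteKey.absolutelyContinuous_prod_count hac) hc3 hc4)
    have hlog2 := FiniteKey.logb_one_sub_δ₂_nonpos ht
    have hkfloor : (k : ℝ) ≤ n * (FiniteKey.condEntropyXZ Q - t.ε - t.ε')
        + Real.logb 2 (1 - FiniteKey.δ₂ n t) - lrec - 2 * t.f n - t.g n - 2 := by
      have h1 : ((FiniteKey.kbar Q n lrec t : ℤ) : ℝ) ≤ _ := Int.floor_le _
      rw [hkt'] at h1
      exact_mod_cast h1
    have hk1 : (1 : ℝ) ≤ k := by exact_mod_cast hkpos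
    -- The 3 is the 2 subtracted inside the floor plus k ≥ 1; every other correction only lowers the
    -- key length.
    have hent3 : lrec + 3 ≤ n * ∫ w, FiniteKey.condInfo volume Q w ∂Q := by
      change lrec + 3 ≤ n * FiniteKey.condEntropyXZ Q
      have h2 : (n : ℝ) * (FiniteKey.condEntropyXZ Q - t.ε - t.ε')
          ≤ n * FiniteKey.condEntropyXZ Q :=
        mul_le_mul_of_nonneg_left (by linarith [ht.1.1, ht.2.1.1]) n.cast_nonneg
      linarith [ht.2.2.2.2.1 n, ht.2.2.2.2.2.1 n]
    have hDk := FiniteKey.sub_condShannon_lt hac hZ hX hF hlawQ hindQ hG hindG hkpos hh hlrec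
      hlrec0 hent3
    set a := n * (FiniteKey.condEntropyXZ Q - t.ε - t.ε') with ha
    have hT : MeasurableSet {ω | FiniteKey.blockDensity volume Q (fun i => Z i ω) (fun i => X i ω)
        ≤ ENNReal.ofReal ((2 : ℝ) ^ (-a))} :=
      measurableSet_le ((FiniteKey.measurable_blockDensity volume Q).comp (hZn.prodMk hXn))
        measurable_const
    refine FiniteKey.lt_min_of_admissible ht hkpos hkt' hDk ?_ measureReal_le_one
      (FiniteKey.sub_condShannon_le hac hZ hX hF hlawQ hindQ hG hindG hh hlrec a rfl)
    rw [← probReal_compl_eq_one_sub hT, ofReal_measureReal]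
    exact FiniteKey.measure_blockDensity_gt_le hac hn hZ hX hlawQ hindQ t.ε t.ε' (by rw [ha, hent])
  have hL := hmain.trans_le (min_le_left _ _)
  have hU := hmain.trans_le (min_le_right _ _)
  refine ⟨?_, ?_, ?_, ?_⟩
  · unfold FiniteKey.mutualInfo; linarith
  · unfold FiniteKey.mutualInfo; linarith
  · unfold FiniteKey.uniformity; rw [hcard]; linarith
  -- Both parties apply the same hash function, so the keys can differ only where the estimate is
  -- wrong.
  · refine measure_mono fun ω hω hcon => hω ?_
    exact congrArg (h (G ω)) hcon.symm
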